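/- Let $n,m\in\mathbb{Z}_{\ge 0}$ and $\theta>0$. Write $z=(z_1,\dots,z_n)$, $w=(w_1,\dots,w_m)$, $z_{n+k}:=w_k$ for $k=1,\dots,m$, and let $p(j)=0$ for $1\le j\le n$ and $p(j)=1$ for $n+1\le j\le n+m$. Let $\Lambda_{n,m,\theta}\subset\mathbb{C}[z,w]$ be the algebra of all polynomials $f$ that are $S_n$-invariant in $z$, $S_m$-invariant in $w$, and satisfy $$\Big(\frac{\partial}{\partial z_j}+\theta\frac{\partial}{\partial w_k}\Big)f\Big|_{z_j=w_k}\equiv 0\qquad (1\le j\le n,\ 1\le k\le m).$$ On the field $\mathbb{C}(z,w)$ of rational functions put $\partial^{(1)}_j=(-\theta)^{p(j)}z_j\frac{\partial}{\partial z_j}$ and, for $r>1$, $$\partial^{(r)}_j=\partial^{(1)}_j\partial^{(r-1)}_j-\frac12\sum_{k\ne j}(-\theta)^{1-p(k)}\frac{z_j+z_k}{z_j-z_k}\big(\partial^{(r-1)}_j-\partial^{(r-1)}_k\big),$$ and let $\mathcal{L}^{(r)}_{n,m,\theta}=\sum_{j=1}^{n+m}(-\theta)^{-p(j)}\partial^{(r)}_j$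 for $r\ge 1$. For $\xi'>\xi>0$ and $f,g\in\Lambda_{n,m,\theta}$ let $$\langle f,g\rangle'_{n,m,\theta}=\frac{1}{n!\,m!}\int_{|z_j|=\xi}d\omega_n(z)\int_{|w_k|=\xi'}d\omega_m(w)\,\Delta_{n,m}(z,w;\theta)\,f(z,w)\,\overline{g(1/\bar z,1/\bar w)},$$ where $d\omega_N(u)=\frac{1}{(2\pi i)^N}\frac{du_1}{u_1}\cdots\frac{du_N}{u_N}$, $\Delta_N(u;\theta)=\prod_{1\le j<k\le N}\big[(1-u_j/u_k)(1-u_k/u_j)\big]^{\theta}$, and $$\Delta_{n,m}(z,w;\theta)=\frac{\Delta_n(z;\theta)\,\Delta_m(w;1/\theta)}{\prod_{j=1}^n\prod_{k=1}^m(1-z_j/w_k)(1-w_k/z_j)}.$$ Then, for every $r\ge 1$, the operator $\mathcal{L}^{(r)}_{n,m,\theta}$ maps $\Lambda_{n,m,\theta}$ into itself, and it is symmetric with respect to this product: for all $\xi'>\xi>0$ and all $f,g\in\Lambda_{n,m,\theta}$, $$\big\langle \mathcal{L}^{(r)}_{n,m,\theta}f,\,g\big\rangle'_{n,m,\theta}=\big\langle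 f,\,\mathcal{L}^{(r)}_{n,m,\theta}g\big\rangle'_{n,m,\theta}.$$ -/

import Mathlib

noncomputable section

open MvPolynomial

namespace DeformedCMS

/-- Index set of the `n + m` variables `(z, w)`: `Sum.inl j` is the index of `z_j` and
`Sum.inr k` is the index of `w_k` (that is, of `z_{n+k}`). -/
abbrev Idx (n m : ℕ) : Type := Fin n ⊕ Fin m

/-- The polynomial ring `ℂ[z, w]`. -/
abbrev Poly (n m : ℕ) : Type := MvPolynomial (Idx n m) ℂ

/-- The field `ℂ(z, w)` of rational functions. -/
abbrev RatFn (n m : ℕ) : Type := FractionRing (Poly n m)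

variable {n m : ℕ}

/-- The parity function: `0` on the `z`-variables, `1` on the `w`-variables. -/
def parity : Idx n m → ℤ
  | Sum.inl _ => 0
  | Sum.inr _ => 1

/-! ### The algebra of quasi-invariants -/

/-- The restriction `p ↦ p|_{z_j = w_k}`, as substitution of `w_k` for `z_j`. -/
def restrictDiag (j : Fin n) (k : Fin m) : Poly n m →ₐ[ℂ] Poly n m :=
  aeval (Function.update (X : Idx n m → Poly n m) (Sum.inl j) (X (Sum.inr k)))

/-- The operator `∂/∂z_j + θ ∂/∂w_k` on polynomials. -/
def quasiDeriv (θ : ℝ) (j : Fin n) (k : Fin m) : Derivation ℂ (Poly n m) (Poly n m) :=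
  pderiv (Sum.inl j) + (θ : ℂ) • pderiv (Sum.inr k)

/-- The algebra `Λ_{n,m,θ}`: polynomials that are `S_n`-invariant in `z`, `S_m`-invariant in `w`,
and satisfy `(∂/∂z_j + θ ∂/∂w_k) p = 0` on `z_j = w_k` for all `j`, `k`. -/
def quasiInvariants (n m : ℕ) (θ : ℝ) : Subalgebra ℂ (Poly n m) where
  carrier := {p |
    (∀ (σ : Equiv.Perm (Fin n)) (τ : Equiv.Perm (Fin m)), rename (Sum.map σ τ) p = p) ∧
    ∀ (j : Fin n) (k : Fin m), restrictDiag j k (quasiDeriv θ j k p) = 0}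
  mul_mem' := by
    rintro p q ⟨hp, hp'⟩ ⟨hq, hq'⟩
    refine ⟨fun σ τ => by rw [map_mul, hp, hq], fun j k => ?_⟩
    rw [Derivation.leibniz]
    simp [hp', hq']
  add_mem' := by
    rintro p q ⟨hp, hp'⟩ ⟨hq, hq'⟩
    exact ⟨fun σ τ => by rw [map_add, hp, hq], fun j k => by simp [hp', hq']⟩
  algebraMap_mem' := fun c => ⟨fun σ τ => AlgHom.commutes _ _, fun j k => by simp⟩

/-! ### Extension of a derivation to the fraction field, and partial derivatives in `ℂ(z, w)` -/

section FractionField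

variable {k A K : Type*} [CommRing k] [CommRing A] [IsDomain A] [Algebra k A] [Field K]
  [Algebra A K] [IsFractionRing A K]

/-- The quotient rule applied to a chosen fraction representing `f`. -/
def quotientRule (d : Derivation k A A) (f : K) : K :=
  (algebraMap A K (d (IsLocalization.sec (nonZeroDivisors A) f).1) *
      algebraMap A K (IsLocalization.sec (nonZeroDivisors A) f).2 -
    algebraMap A K (IsLocalization.sec (nonZeroDivisors A) f).1 *
      algebraMap A K (d ((IsLocalization.sec (nonZeroDivisors A) f).2 : A))) /
    algebraMap A K (IsLocalization.sec (nonZeroDivisors A) f).2 ^ 2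

/-- The result does not depend on the chosen fraction. -/
theorem quotientRule_div (d : Derivation k A A) (a b : A) (hb : b ≠ 0) :
    quotientRule d (algebraMap A K a / algebraMap A K b) =
      (algebraMap A K (d a) * algebraMap A K b - algebraMap A K a * algebraMap A K (d b)) /
        algebraMap A K b ^ 2 := by
  have inj : Function.Injective (algebraMap A K) := IsFractionRing.injective _ _
  have hb' : algebraMap A K b ≠ 0 := (map_ne_zero_iff _ inj).2 hb
  unfold quotientRule
  set f : K := algebraMap A K a / algebraMap A K b with hf
  have key := IsLocalization.sec_spec (nonZeroDivisors A) f
  have hd : ((IsLocalization.sec (nonZeroDivisors A) f).2 : A) ≠ 0 :=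
    nonZeroDivisors.coe_ne_zero _
  generalize (IsLocalization.sec (nonZeroDivisors A) f).1 = u at *
  generalize ((IsLocalization.sec (nonZeroDivisors A) f).2 : A) = v at *
  have hv' : algebraMap A K v ≠ 0 := (map_ne_zero_iff _ inj).2 hd
  have e : a * v = u * b := by
    apply inj
    rw [hf, div_mul_eq_mul_div, div_eq_iff hb'] at key
    rw [map_mul, map_mul, key]
  have e' := congrArg d e
  simp only [Derivation.leibniz, smul_eq_mul] at e'
  rw [div_eq_div_iff (pow_ne_zero 2 hv') (pow_ne_zero 2 hb')]
  simp only [← map_mul, ← map_sub, ← map_pow]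
  congr 1
  linear_combination (-(b * v)) * e' + (d b * v + b * d v) * e

variable [Algebra k K] [IsScalarTower k A K]

/-- The extension of a derivation of `A` to the fraction field `K` of `A`. -/
def fracDeriv (d : Derivation k A A) : Derivation k K K :=
  Derivation.mk'
    { toFun := quotientRule d
      map_add' := by
        intro f g
        obtain ⟨a, b, hb, rfl⟩ := IsFractionRing.div_surjective (A := A) f
        obtain ⟨c, e, he, rfl⟩ := IsFractionRing.div_surjective (A := A) g
        have inj : Function.Injective (algebraMap A K) := IsFractionRing.injective _ _
        have hb0 := nonZeroDivisors.ne_zero hb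
        have he0 := nonZeroDivisors.ne_zero he
        have hb' : algebraMap A K b ≠ 0 := (map_ne_zero_iff _ inj).2 hb0
        have he' : algebraMap A K e ≠ 0 := (map_ne_zero_iff _ inj).2 he0
        rw [div_add_div _ _ hb' he']
        simp only [← map_mul, ← map_add]
        rw [quotientRule_div d _ _ (mul_ne_zero hb0 he0), quotientRule_div d _ _ hb0,
          quotientRule_div d _ _ he0]
        simp only [map_add, Derivation.leibniz, smul_eq_mul, map_mul]
        field_simp
        ring
      map_smul' := by
        intro r f
        obtain ⟨a, b, hb, rfl⟩ := IsFractionRing.div_surjective (A := A) f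
        have hb0 := nonZeroDivisors.ne_zero hb
        have hs : ∀ x : A, algebraMap A K (r • x) = r • algebraMap A K x := fun x => by
          rw [Algebra.smul_def, map_mul, ← IsScalarTower.algebraMap_apply, ← Algebra.smul_def]
        rw [← smul_div_assoc, ← hs, quotientRule_div d _ _ hb0, quotientRule_div d _ _ hb0]
        simp only [Derivation.map_smul, hs, RingHom.id_apply, smul_mul_assoc]
        rw [← smul_sub, smul_div_assoc] }
    (by
      intro f g
      obtain ⟨a, b, hb, rfl⟩ := IsFractionRing.div_surjective (A := A) f
      obtain ⟨c, e, he, rfl⟩ := IsFractionRing.div_surjective (A := A) g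
      have inj : Function.Injective (algebraMap A K) := IsFractionRing.injective _ _
      have hb0 := nonZeroDivisors.ne_zero hb
      have he0 := nonZeroDivisors.ne_zero he
      have hb' : algebraMap A K b ≠ 0 := (map_ne_zero_iff _ inj).2 hb0
      have he' : algebraMap A K e ≠ 0 := (map_ne_zero_iff _ inj).2 he0
      change quotientRule d _ = _ • quotientRule d _ + _ • quotientRule d _
      rw [div_mul_div_comm]
      simp only [← map_mul]
      rw [quotientRule_div d _ _ (mul_ne_zero hb0 he0), quotientRule_div d _ _ hb0,
        quotientRule_div d _ _ he0]
      simp only [map_add, Derivation.leibniz, smul_eq_mul, map_mul]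
      field_simp
      ring)

/-- The extended derivation agrees with the given one on `A`. -/
theorem fracDeriv_algebraMap (d : Derivation k A A) (a : A) :
    fracDeriv d (algebraMap A K a) = algebraMap A K (d a) := by
  have h := quotientRule_div (K := K) d a 1 one_ne_zero
  simp only [map_one, div_one, Derivation.map_one_eq_zero, map_zero, mul_zero, sub_zero, mul_one,
    one_pow] at h
  exact h

end FractionField

/-- The partial derivative `∂/∂z_i` on `ℂ(z, w)`. -/
def ratDeriv (i : Idx n m) : Derivation ℂ (RatFn n m) (RatFn n m) :=
  fracDeriv (pderiv i : Derivation ℂ (Poly n m) (Poly n m))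

/-! ### The quantum integrals -/

/-- The coordinate `z_i` (with `z_{n+k} = w_k`) as a rational function. -/
def coord (i : Idx n m) : RatFn n m := algebraMap (Poly n m) (RatFn n m) (X i)

/-- The operator `∂^{(1)}_j = (-θ)^{p(j)} z_j ∂/∂z_j`. -/
def pdoOne (θ : ℝ) (j : Idx n m) : RatFn n m →ₗ[ℂ] RatFn n m :=
  (-(θ : ℂ)) ^ parity j • (LinearMap.mulLeft ℂ (coord j) ∘ₗ (ratDeriv j).toLinearMap)

/-- The operators `∂^{(r)}_j`, `r ≥ 1`, defined recursively by
`∂^{(r)}_j = ∂^{(1)}_j ∂^{(r-1)}_j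
  - (1/2) ∑_{k ≠ j} (-θ)^{1-p(k)} (z_j + z_k)/(z_j - z_k) (∂^{(r-1)}_j - ∂^{(r-1)}_k)`.
The value at `r = 0` is a convention. -/
def pdo (θ : ℝ) : ℕ → Idx n m → (RatFn n m →ₗ[ℂ] RatFn n m)
  | 0, _ => LinearMap.id
  | 1, j => pdoOne θ j
  | r + 2, j => pdoOne θ j ∘ₗ pdo θ (r + 1) j -
      (1 / 2 : ℂ) • ∑ k ∈ Finset.univ.erase j, (-(θ : ℂ)) ^ (1 - parity k) •
        (LinearMap.mulLeft ℂ ((coord j + coord k) / (coord j - coord k)) ∘ₗ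
          (pdo θ (r + 1) j - pdo θ (r + 1) k))

/-- The quantum integral `L^{(r)}_{n,m,θ} = ∑_j (-θ)^{-p(j)} ∂^{(r)}_j`. -/
def quantumIntegral (n m : ℕ) (θ : ℝ) (r : ℕ) : RatFn n m →ₗ[ℂ] RatFn n m :=
  ∑ j : Idx n m, (-(θ : ℂ)) ^ (-parity j) • pdo θ r j

/-! ### The sesquilinear product -/

/-- The weight `Δ_N(z;θ) = ∏_{j<k} [(1 - z_j/z_k)(1 - z_k/z_j)]^θ`. On a torus `|z_j| = ξ` every
base is the nonnegative real number `|1 - z_j/z_k|²`, and the power is its real power. -/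
def weight {N : ℕ} (θ : ℝ) (z : Fin N → ℂ) : ℂ :=
  ∏ j : Fin N, ∏ k ∈ Finset.Ioi j, ((1 - z j / z k) * (1 - z k / z j)) ^ (θ : ℂ)

/-- The weight `Δ_{n,m}(z,w;θ)`. -/
def superWeight (θ : ℝ) (z : Fin n → ℂ) (w : Fin m → ℂ) : ℂ :=
  weight θ z * weight (1 / θ) w /
    ∏ j : Fin n, ∏ k : Fin m, ((1 - z j / w k) * (1 - w k / z j))

/-- The value of `q^*` at `x`: the complex conjugate of `q` at the point `1 / conj x`. -/
def conjEval (q : Poly n m) (x : Idx n m → ℂ) : ℂ :=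
  starRingEnd ℂ (eval (fun i => (starRingEnd ℂ (x i))⁻¹) q)

/-- Integration `∫_{T_ξ^N} f dω_N` over the torus `|z_j| = ξ`, where
`dω_N = (2πi)^{-N} (dz_1/z_1) ⋯ (dz_N/z_N)`. -/
def torusMean {N : ℕ} (ξ : ℝ) (f : (Fin N → ℂ) → ℂ) : ℂ :=
  1 / (2 * Real.pi * Complex.I) ^ N *
    torusIntegral (fun z => (∏ j, z j)⁻¹ * f z) 0 (fun _ => ξ)

/-- The product `⟨p, q⟩'_{n,m,θ}`, formed with the tori of radii `ξ` (for `z`) and `ξ'`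
(for `w`). -/
def hermProd (θ ξ ξ' : ℝ) (p q : Poly n m) : ℂ :=
  1 / ((n.factorial : ℂ) * (m.factorial : ℂ)) *
    torusMean ξ fun z : Fin n → ℂ => torusMean ξ' fun w : Fin m → ℂ =>
      superWeight θ z w * eval (Sum.elim z w) p * conjEval q (Sum.elim z w)

end DeformedCMS

end

noncomputable section

open MvPolynomial

namespace DeformedCMS

variable {n m : ℕ}

/-! ### Divisibility by a difference of variables -/

section Divisibility

variable {σ R : Type*} [DecidableEq σ] [CommRing R]

/-! A single function `∂_i^{(r)} p` need not lie in Λ, so the induction on `r` carries the whole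
family `F_i = ∂_i^{(r)} p` (`IsQuasiFamily`). The family is permuted by `S_n × S_m`. On `z_j = w_k`
the members `F_{z_j}` and `F_{w_k}` agree, and the other members satisfy the quasi-invariance
condition of that pair. For the two members themselves that condition is replaced by a crossed one,
`∂F_{w_k}/∂z_j + θ ∂F_{z_j}/∂w_k = 0`. Symmetry and agreement make `F_i - F_k` divisible by `x_i -
x_k`, so the recursion stays in polynomials. Expanding the divided differences to second order along
`z_j = w_k` shows that the properties persist (`IsStep.isQuasiFamily`), and they put the weighted
sum in Λ (`IsQuasiFamily.sum_mem`).

Symmetry reduces to one step of the recursion. With `c_i = (-θ)^{-p(i)}`, `sum_angleForm_step` says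
`∑ c_i ⟨F'_i, G_i⟩ = ∑ c_i ⟨F_i, G'_i⟩` for any two families with polynomial divided differences.
Moving `r` steps one at a time from the left to the right (`sum_angleForm_chain`), between chains
that start at the constant families `p` and `q`, gives the theorem.

One step is an integration by parts. Integrate `∂/∂t_i` of `Δ a_i b_i` over the angles, where `a_i`
and `b_i` are the values of `F_i` and of the conjugate of `G_i`, and sum over `i`. Since Δ is a
product over pairs of functions of `t_i - t_k`, it contributes multiples of `(x_i + x_k)/(x_i - x_k)
(a_i b_i - a_k b_k)`. The discrete product rule splits these into divided differences of `a` and of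
`b`, the terms of the two recursions, and the exponents in Δ give the right constants
(`pairCoeff_add_pairCoeff`). For small exponents Δ is not differentiable where angles coincide. So
`|1 - e^{is}|²` is replaced by `|1 - e^{is}|² + ε`; this multiplies the logarithmic derivative by a
damping factor in `[0, 1]`, and `ε → 0` by dominated convergence
(`integral_pairProd_zero_mul_eq_zero`). The mixed factors are smooth because `ξ < ξ'`. -/

theorem X_sub_X_dvd_sub_aeval_update (i k : σ) (p : MvPolynomial σ R) :
    (X i - X k : MvPolynomial σ R) ∣
      p - aeval (Function.update (X : σ → MvPolynomial σ R) i (X k)) p := by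
  induction p using MvPolynomial.induction_on with
  | C a => simp
  | add p q hp hq =>
    rw [map_add, add_sub_add_comm]
    exact dvd_add hp hq
  | mul_X p l hp =>
    rw [map_mul, aeval_X]
    set ρ : MvPolynomial σ R →ₐ[R] MvPolynomial σ R :=
      aeval (Function.update (X : σ → MvPolynomial σ R) i (X k))
    have h : (X i - X k : MvPolynomial σ R) ∣
        X l - Function.update (X : σ → MvPolynomial σ R) i (X k) l := by
      by_cases hl : l = i
      · subst hl; simp
      · simp [Function.update_of_ne hl]
    have e : p * X l - ρ p * Function.update (X : σ → MvPolynomial σ R) i (X k) l =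
        (p - ρ p) * X l +
          ρ p * (X l - Function.update (X : σ → MvPolynomial σ R) i (X k) l) := by ring
    rw [e]
    exact dvd_add (hp.mul_right _) (h.mul_left _)

theorem X_sub_X_dvd_of_aeval_update_eq_zero {i k : σ} {p : MvPolynomial σ R}
    (hp : aeval (Function.update (X : σ → MvPolynomial σ R) i (X k)) p = 0) :
    (X i - X k : MvPolynomial σ R) ∣ p := by
  have h := X_sub_X_dvd_sub_aeval_update i k p
  rwa [hp, sub_zero] at h

end Divisibility

theorem X_sub_X_ne_zero {σ R : Type*} [CommRing R] [Nontrivial R] {i k : σ} (h : i ≠ k) :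
    (X i - X k : MvPolynomial σ R) ≠ 0 :=
  sub_ne_zero.2 fun e => h (X_injective e)

theorem pderiv_pderiv_comm {σ R : Type*} [CommRing R] (i j : σ) (p : MvPolynomial σ R) :
    pderiv i (pderiv j p) = pderiv j (pderiv i p) := by
  classical
  have h : ⁅(pderiv i : Derivation R (MvPolynomial σ R) (MvPolynomial σ R)),
      (pderiv j : Derivation R (MvPolynomial σ R) (MvPolynomial σ R))⁆ = 0 := by
    apply MvPolynomial.derivation_ext
    intro l
    simp [Derivation.commutator_apply, pderiv_X, Pi.single_apply, apply_ite]
  have := congrArg (fun D : Derivation R (MvPolynomial σ R) (MvPolynomial σ R) => D p) h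
  simpa [Derivation.commutator_apply, sub_eq_zero] using this

/-! ### Quasi-invariant families and the recursion step -/

/-- A family `F_i` of polynomials, indexed by the variables, with the symmetry and quasi-invariance
properties of the family `∂_i^{(r)} p` for `p` in `Λ_{n,m,θ}`. -/
structure IsQuasiFamily (θ : ℝ) (F : Idx n m → Poly n m) : Prop where
  rename_eq : ∀ (σ : Equiv.Perm (Fin n)) (τ : Equiv.Perm (Fin m)) (i : Idx n m),
    rename (Sum.map σ τ) (F i) = F (Sum.map σ τ i)
  restrict_eq : ∀ j k, restrictDiag j k (F (Sum.inl j)) = restrictDiag j k (F (Sum.inr k))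
  restrict_cross : ∀ j k, restrictDiag j k (pderiv (Sum.inl j) (F (Sum.inr k)) +
    C (θ : ℂ) * pderiv (Sum.inr k) (F (Sum.inl j))) = 0
  restrict_quasiDeriv : ∀ j k l, l ≠ Sum.inl j → l ≠ Sum.inr k →
    restrictDiag j k (quasiDeriv θ j k (F l)) = 0

/-- The polynomial divided difference form of the recursion defining `∂_i^{(r)}`. -/
def IsStep (θ : ℝ) (F F' : Idx n m → Poly n m) : Prop :=
  ∃ D : Idx n m → Idx n m → Poly n m,
    (∀ i k, F i - F k = (X i - X k) * D i k) ∧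
    ∀ i, F' i = C ((-(θ : ℂ)) ^ parity i) * (X i * pderiv i (F i)) -
      C (1 / 2 : ℂ) * ∑ k ∈ Finset.univ.erase i,
        C ((-(θ : ℂ)) ^ (1 - parity k)) * ((X i + X k) * D i k)

theorem quasiDeriv_apply (θ : ℝ) (j : Fin n) (k : Fin m) (p : Poly n m) :
    quasiDeriv θ j k p = pderiv (Sum.inl j) p + C (θ : ℂ) * pderiv (Sum.inr k) p := by
  rw [quasiDeriv, Derivation.add_apply, Derivation.smul_apply, smul_eq_C_mul]

theorem restrictDiag_X_of_ne {j : Fin n} {k : Fin m} {l : Idx n m} (h : l ≠ Sum.inl j) :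
    restrictDiag j k (X l) = X l := by
  simp [restrictDiag, Function.update_of_ne h]

theorem restrictDiag_X_inl (j : Fin n) (k : Fin m) :
    restrictDiag j k (X (Sum.inl j)) = X (Sum.inr k) := by
  simp [restrictDiag]

theorem restrictDiag_C (j : Fin n) (k : Fin m) (c : ℂ) :
    restrictDiag j k (C c) = C c :=
  (restrictDiag j k).commutes c

/-- The derivative in a third variable treats `z_j - w_k` as a constant, so it preserves the ideal
that this difference generates. -/
theorem restrictDiag_pderiv_of_restrictDiag_eq_zero {j : Fin n} {k : Fin m} {l : Idx n m}
    (h1 : l ≠ Sum.inl j) (h2 : l ≠ Sum.inr k) {p : Poly n m} (hp : restrictDiag j k p = 0) :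
    restrictDiag j k (pderiv l p) = 0 := by
  obtain ⟨q, rfl⟩ := X_sub_X_dvd_of_aeval_update_eq_zero hp
  rw [pderiv_mul, map_sub, pderiv_X_of_ne h1.symm, pderiv_X_of_ne h2.symm]
  simp [restrictDiag_X_inl, restrictDiag_X_of_ne]

theorem aeval_update_rename_swap {σ : Type*} [DecidableEq σ] {R : Type*} [CommRing R] (i k : σ)
    (p : MvPolynomial σ R) :
    aeval (Function.update (X : σ → MvPolynomial σ R) i (X k)) (rename (Equiv.swap i k) p) =
      aeval (Function.update (X : σ → MvPolynomial σ R) i (X k)) p := by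
  rw [aeval_rename]
  congr 1
  congr 1
  funext l
  by_cases h1 : l = i
  · subst h1
    by_cases h : l = k
    · subst h; simp
    · simp [Function.update_of_ne (Ne.symm h)]
  by_cases h2 : l = k
  · subst h2
    simp [Function.update_of_ne h1]
  · simp [Equiv.swap_apply_of_ne_of_ne h1 h2]

theorem sumMap_swap_inl (j k : Fin n) :
    Sum.map (Equiv.swap j k) (1 : Equiv.Perm (Fin m)) = Equiv.swap (Sum.inl j) (Sum.inl k) := by
  funext l
  rcases l with l | l
  · simp only [Sum.map_inl, Equiv.swap_apply_def, Sum.inl.injEq]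
    split_ifs <;> rfl
  · simp [Equiv.swap_apply_of_ne_of_ne]

theorem sumMap_swap_inr (j k : Fin m) :
    Sum.map (1 : Equiv.Perm (Fin n)) (Equiv.swap j k) = Equiv.swap (Sum.inr j) (Sum.inr k) := by
  funext l
  rcases l with l | l
  · simp [Equiv.swap_apply_of_ne_of_ne]
  · simp only [Sum.map_inr, Equiv.swap_apply_def, Sum.inr.injEq]
    split_ifs <;> rfl

/-- For two variables of the same kind, the transposition exchanges the two members and becomes
invisible once the variables are identified; for mixed kinds this is the agreement on `z_j = w_k`.
-/
theorem IsQuasiFamily.dvd_sub {θ : ℝ} {F : Idx n m → Poly n m} (hF : IsQuasiFamily θ F)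
    (i k : Idx n m) : (X i - X k : Poly n m) ∣ F i - F k := by
  rcases i with i | i <;> rcases k with k | k
  · apply X_sub_X_dvd_of_aeval_update_eq_zero
    have h := hF.rename_eq (Equiv.swap i k) 1 (Sum.inl i)
    rw [sumMap_swap_inl, Equiv.swap_apply_left] at h
    rw [map_sub, ← h, aeval_update_rename_swap, sub_self]
  · apply X_sub_X_dvd_of_aeval_update_eq_zero
    rw [map_sub, sub_eq_zero]
    exact hF.restrict_eq i k
  · rw [← neg_dvd, neg_sub, ← dvd_neg, neg_sub]
    apply X_sub_X_dvd_of_aeval_update_eq_zero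
    rw [map_sub, sub_eq_zero]
    exact hF.restrict_eq k i
  · apply X_sub_X_dvd_of_aeval_update_eq_zero
    have h := hF.rename_eq 1 (Equiv.swap i k) (Sum.inr i)
    rw [sumMap_swap_inr, Equiv.swap_apply_left] at h
    rw [map_sub, ← h, aeval_update_rename_swap, sub_self]

theorem IsQuasiFamily.exists_isStep {θ : ℝ} {F : Idx n m → Poly n m} (hF : IsQuasiFamily θ F) :
    ∃ F', IsStep θ F F' := by
  choose D hD using hF.dvd_sub
  exact ⟨_, D, hD, fun i => rfl⟩

/-- Start of the recursion: for a constant family the crossed relation is the quasi-invariance of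
`p` itself. -/
theorem isQuasiFamily_const {θ : ℝ} {p : Poly n m} (hp : p ∈ quasiInvariants n m θ) :
    IsQuasiFamily θ (fun _ => p) where
  rename_eq σ τ _ := hp.1 σ τ
  restrict_eq _ _ := rfl
  restrict_cross j k := by rw [← quasiDeriv_apply]; exact hp.2 j k
  restrict_quasiDeriv j k _ _ _ := hp.2 j k

theorem parity_sumMap (σ : Equiv.Perm (Fin n)) (τ : Equiv.Perm (Fin m)) (i : Idx n m) :
    parity (Sum.map σ τ i) = parity i := by
  cases i <;> rfl

theorem IsStep.rename_eq {θ : ℝ} {F F' : Idx n m → Poly n m} (hF : IsQuasiFamily θ F)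
    (h : IsStep θ F F') (σ : Equiv.Perm (Fin n)) (τ : Equiv.Perm (Fin m)) (i : Idx n m) :
    rename (Sum.map σ τ) (F' i) = F' (Sum.map σ τ i) := by
  obtain ⟨D, hD, hF'⟩ := h
  set π : Equiv.Perm (Idx n m) := Equiv.sumCongr σ τ with hπ
  have hcoe : Sum.map σ τ = π := rfl
  have hpar : ∀ i, parity (π i) = parity i := parity_sumMap σ τ
  have hren : ∀ i, rename π (F i) = F (π i) := hF.rename_eq σ τ
  -- The diagonal values `D i i` are unconstrained, hence the restriction to `i ≠ k`.
  have hDren : ∀ i k, i ≠ k → rename π (D i k) = D (π i) (π k) := by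
    intro i k hik
    apply mul_left_cancel₀ (X_sub_X_ne_zero (R := ℂ) (π.injective.ne hik))
    rw [← hD, ← hren, ← hren, ← map_sub, hD, map_mul, map_sub, rename_X, rename_X]
  rw [hcoe, hF', hF', map_sub, map_mul, map_mul, map_mul, map_sum, rename_C, rename_C, rename_X,
    ← pderiv_rename π.injective, hren, hpar]
  congr 2
  refine Finset.sum_bij' (fun k _ => π k) (fun k _ => π.symm k) ?_ ?_ ?_ ?_ ?_
  · intro k hk; simpa using hk
  · intro k hk
    simp only [Finset.mem_erase, Finset.mem_univ, and_true] at hk ⊢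
    rwa [Ne, Equiv.symm_apply_eq]
  · simp
  · simp
  · intro k hk
    rw [map_mul, map_mul, map_add, rename_C, rename_X, rename_X, hpar,
      hDren i k (Finset.ne_of_mem_erase hk).symm]

theorem parity_inl (j : Fin n) : parity (Sum.inl j : Idx n m) = 0 := rfl

theorem parity_inr (k : Fin m) : parity (Sum.inr k : Idx n m) = 1 := rfl

section Step

variable {θ : ℝ} {F F' : Idx n m → Poly n m} {D : Idx n m → Idx n m → Poly n m}

theorem dividedDiff_symm (hD : ∀ i k, F i - F k = (X i - X k) * D i k) {i k : Idx n m}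
    (h : i ≠ k) : D i k = D k i := by
  apply mul_left_cancel₀ (X_sub_X_ne_zero (R := ℂ) h)
  linear_combination -hD i k - hD k i

variable (j : Fin n) (k : Fin m)

/-- Separates the term coupling `z_j` with `w_k`, which behaves differently on `z_j = w_k`, from the
rest of the sum. Its weight is `1` here and `-θ` in `step_inr`. -/
theorem step_inl
    (hF' : ∀ i, F' i = C ((-(θ : ℂ)) ^ parity i) * (X i * pderiv i (F i)) -
      C (1 / 2 : ℂ) * ∑ k ∈ Finset.univ.erase i,
        C ((-(θ : ℂ)) ^ (1 - parity k)) * ((X i + X k) * D i k)) :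
    F' (Sum.inl j) = X (Sum.inl j) * pderiv (Sum.inl j) (F (Sum.inl j)) -
      C (1 / 2 : ℂ) * ((X (Sum.inl j) + X (Sum.inr k)) * D (Sum.inl j) (Sum.inr k) +
        ∑ l ∈ (Finset.univ.erase (Sum.inl j)).erase (Sum.inr k),
          C ((-(θ : ℂ)) ^ (1 - parity l)) * ((X (Sum.inl j) + X l) * D (Sum.inl j) l)) := by
  have hmem : (Sum.inr k : Idx n m) ∈ Finset.univ.erase (Sum.inl j) := by simp
  rw [hF', ← Finset.add_sum_erase _ _ hmem, parity_inl, parity_inr]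
  simp

theorem step_inr (hsymm : D (Sum.inr k) (Sum.inl j) = D (Sum.inl j) (Sum.inr k))
    (hF' : ∀ i, F' i = C ((-(θ : ℂ)) ^ parity i) * (X i * pderiv i (F i)) -
      C (1 / 2 : ℂ) * ∑ k ∈ Finset.univ.erase i,
        C ((-(θ : ℂ)) ^ (1 - parity k)) * ((X i + X k) * D i k)) :
    F' (Sum.inr k) = - (C (θ : ℂ) * (X (Sum.inr k) * pderiv (Sum.inr k) (F (Sum.inr k)))) -
      C (1 / 2 : ℂ) * (-(C (θ : ℂ) * ((X (Sum.inl j) + X (Sum.inr k)) *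
        D (Sum.inl j) (Sum.inr k))) +
        ∑ l ∈ (Finset.univ.erase (Sum.inl j)).erase (Sum.inr k),
          C ((-(θ : ℂ)) ^ (1 - parity l)) * ((X (Sum.inr k) + X l) * D (Sum.inr k) l)) := by
  have hmem : (Sum.inl j : Idx n m) ∈ Finset.univ.erase (Sum.inr k) := by simp
  rw [hF', ← Finset.add_sum_erase _ _ hmem, parity_inl, parity_inr, Finset.erase_right_comm,
    hsymm]
  simp only [zpow_one, sub_zero, map_neg]
  ring

end Step

theorem C_half_mul_two : (C (1 / 2 : ℂ) : Poly n m) * 2 = 1 := by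
  rw [show (2 : Poly n m) = C 2 from (map_ofNat C 2).symm, ← map_mul]
  norm_num

/-! ### One recursion step along `z_j = w_k` -/

section Step

variable {θ : ℝ} {F F' : Idx n m → Poly n m} {D : Idx n m → Idx n m → Poly n m}
  (hD : ∀ i k, F i - F k = (X i - X k) * D i k) (j : Fin n) (k : Fin m)
include hD

/-- Differentiating `(z_j - w_k) D`, only the derivative of the first factor survives on `z_j =
w_k`. -/
theorem restrictDiag_pderiv_inl_sub :
    restrictDiag j k (pderiv (Sum.inl j) (F (Sum.inl j))) -
      restrictDiag j k (pderiv (Sum.inl j) (F (Sum.inr k))) =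
        restrictDiag j k (D (Sum.inl j) (Sum.inr k)) := by
  have h := congrArg (fun p => restrictDiag j k (pderiv (Sum.inl j) p))
    (hD (Sum.inl j) (Sum.inr k))
  simpa [pderiv_mul, pderiv_X_of_ne, restrictDiag_X_inl, restrictDiag_X_of_ne] using h

theorem restrictDiag_pderiv_inr_sub :
    restrictDiag j k (pderiv (Sum.inr k) (F (Sum.inl j))) -
      restrictDiag j k (pderiv (Sum.inr k) (F (Sum.inr k))) =
        -restrictDiag j k (D (Sum.inl j) (Sum.inr k)) := by
  have h := congrArg (fun p => restrictDiag j k (pderiv (Sum.inr k) p))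
    (hD (Sum.inl j) (Sum.inr k))
  simpa [pderiv_mul, pderiv_X_of_ne, restrictDiag_X_inl, restrictDiag_X_of_ne] using h

theorem restrictDiag_pderiv_pderiv_sub :
    restrictDiag j k (pderiv (Sum.inl j) (pderiv (Sum.inr k) (F (Sum.inl j)))) -
      restrictDiag j k (pderiv (Sum.inl j) (pderiv (Sum.inr k) (F (Sum.inr k)))) =
        restrictDiag j k (pderiv (Sum.inr k) (D (Sum.inl j) (Sum.inr k))) -
          restrictDiag j k (pderiv (Sum.inl j) (D (Sum.inl j) (Sum.inr k))) := by
  have h := congrArg (fun p => restrictDiag j k (pderiv (Sum.inl j) (pderiv (Sum.inr k) p)))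
    (hD (Sum.inl j) (Sum.inr k))
  simp [restrictDiag_X_inl, restrictDiag_X_of_ne] at h
  linear_combination h

variable (hF : IsQuasiFamily θ F)
include hF

omit hD in
theorem restrictDiag_cross_eq :
    restrictDiag j k (pderiv (Sum.inl j) (F (Sum.inr k))) +
      C (θ : ℂ) * restrictDiag j k (pderiv (Sum.inr k) (F (Sum.inl j))) = 0 := by
  have h := hF.restrict_cross j k
  rwa [map_add, map_mul, restrictDiag_C] at h

theorem restrictDiag_dividedDiff_eq {l : Idx n m} (h1 : l ≠ Sum.inl j) (h2 : l ≠ Sum.inr k) :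
    restrictDiag j k (D (Sum.inl j) l) = restrictDiag j k (D (Sum.inr k) l) := by
  apply mul_left_cancel₀ (X_sub_X_ne_zero (R := ℂ) h2.symm)
  have e1 := congrArg (restrictDiag j k) (hD (Sum.inl j) l)
  have e2 := congrArg (restrictDiag j k) (hD (Sum.inr k) l)
  simp only [map_sub, map_mul, restrictDiag_X_inl, restrictDiag_X_of_ne h1,
    restrictDiag_X_of_ne (Sum.inr_ne_inl : (Sum.inr k : Idx n m) ≠ Sum.inl j)] at e1 e2
  linear_combination -e1 + e2 + hF.restrict_eq j k

/-- Each derivative is taken in a variable absent from the linear factor `x_i - x_l`, so it passes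
to the divided difference. What remains is the crossed relation minus the quasi-invariance of `F_l`.
-/
theorem restrictDiag_cross_dividedDiff {l : Idx n m} (h1 : l ≠ Sum.inl j) (h2 : l ≠ Sum.inr k) :
    restrictDiag j k (pderiv (Sum.inl j) (D (Sum.inr k) l)) +
      C (θ : ℂ) * restrictDiag j k (pderiv (Sum.inr k) (D (Sum.inl j) l)) = 0 := by
  apply mul_left_cancel₀ (X_sub_X_ne_zero (R := ℂ) h2.symm)
  have e1 := congrArg (fun p => restrictDiag j k (pderiv (Sum.inr k) p)) (hD (Sum.inl j) l)
  have e2 := congrArg (fun p => restrictDiag j k (pderiv (Sum.inl j) p)) (hD (Sum.inr k) l)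
  have e3 := hF.restrict_quasiDeriv j k l h1 h2
  simp [restrictDiag_X_inl, restrictDiag_X_of_ne, h1, h2] at e1 e2
  rw [quasiDeriv_apply, map_add, map_mul, restrictDiag_C] at e3
  linear_combination -e2 - C (θ : ℂ) * e1 + restrictDiag_cross_eq j k hF - e3

omit hF hD in
theorem inr_ne_inl' : (Sum.inr k : Idx n m) ≠ Sum.inl j := Sum.inr_ne_inl

/-- The part of the sum in the recursion step for `i` that avoids the variables `z_j`, `w_k`. -/
def stepRest (θ : ℝ) (D : Idx n m → Idx n m → Poly n m) (j : Fin n) (k : Fin m) (i : Idx n m) :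
    Poly n m :=
  ∑ l ∈ (Finset.univ.erase (Sum.inl j)).erase (Sum.inr k),
    C ((-(θ : ℂ)) ^ (1 - parity l)) * ((X i + X l) * D i l)

theorem restrictDiag_stepRest :
    restrictDiag j k (stepRest θ D j k (Sum.inl j)) =
      restrictDiag j k (stepRest θ D j k (Sum.inr k)) := by
  simp only [stepRest, map_sum]
  refine Finset.sum_congr rfl fun l hl => ?_
  simp only [Finset.mem_erase, Finset.mem_univ, and_true] at hl
  simp only [map_mul, map_add, restrictDiag_X_inl, restrictDiag_X_of_ne hl.2, restrictDiag_C,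
    restrictDiag_X_of_ne (inr_ne_inl' j k), restrictDiag_dividedDiff_eq hD j k hF hl.2 hl.1]

theorem restrictDiag_cross_stepRest :
    restrictDiag j k (pderiv (Sum.inl j) (stepRest θ D j k (Sum.inr k))) +
      C (θ : ℂ) * restrictDiag j k (pderiv (Sum.inr k) (stepRest θ D j k (Sum.inl j))) = 0 := by
  simp only [stepRest, map_sum, Finset.mul_sum, ← Finset.sum_add_distrib]
  refine Finset.sum_eq_zero fun l hl => ?_
  simp only [Finset.mem_erase, Finset.mem_univ, and_true] at hl
  simp only [pderiv_C, pderiv_mul, map_mul, map_add, restrictDiag_X_inl,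
    restrictDiag_X_of_ne hl.2, restrictDiag_C, restrictDiag_X_of_ne (inr_ne_inl' j k),
    pderiv_X_of_ne hl.1, pderiv_X_of_ne hl.2, pderiv_X_of_ne (inr_ne_inl' j k),
    pderiv_X_of_ne (inr_ne_inl' j k).symm, map_zero]
  linear_combination C ((-(θ : ℂ)) ^ (1 - parity l)) * (X (Sum.inr k) + X l) *
    restrictDiag_cross_dividedDiff hD j k hF hl.2 hl.1

variable
    (hF' : ∀ i, F' i = C ((-(θ : ℂ)) ^ parity i) * (X i * pderiv i (F i)) -
      C (1 / 2 : ℂ) * ∑ k ∈ Finset.univ.erase i,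
        C ((-(θ : ℂ)) ^ (1 - parity k)) * ((X i + X k) * D i k))
include hF'

/-- On `z_j = w_k` the coefficient `(z_j + w_k)/2` is `w_k`. The pair term then turns
`∂F_{z_j}/∂z_j` into `∂F_{w_k}/∂z_j`, and symmetrically `∂F_{w_k}/∂w_k` into `∂F_{z_j}/∂w_k`; the
crossed relation equates the results. -/
theorem step_restrict_eq :
    restrictDiag j k (F' (Sum.inl j)) = restrictDiag j k (F' (Sum.inr k)) := by
  have hs := restrictDiag_stepRest hD j k hF
  rw [step_inl j k hF', step_inr j k (dividedDiff_symm hD (by simp)) hF', ← stepRest, ← stepRest]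
  simp only [map_sub, map_neg, map_add, map_mul, restrictDiag_C,
    restrictDiag_X_inl, restrictDiag_X_of_ne (inr_ne_inl' j k)]
  have h2 := C_half_mul_two (n := n) (m := m)
  have r1 := restrictDiag_pderiv_inl_sub hD j k
  have r2 := restrictDiag_pderiv_inr_sub hD j k
  have r3 := restrictDiag_cross_eq j k hF
  linear_combination X (Sum.inr k) * r1 + X (Sum.inr k) * r3 - X (Sum.inr k) * C (θ : ℂ) * r2 -
    X (Sum.inr k) * restrictDiag j k (D (Sum.inl j) (Sum.inr k)) * (1 + C (θ : ℂ)) * h2 -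
    C (1 / 2) * hs

/-- The leading terms differ by a mixed second derivative of `(z_j - w_k) D`, that is `∂D/∂w_k -
∂D/∂z_j` on the diagonal, and the pair terms contribute its negative. -/
theorem step_restrict_cross :
    restrictDiag j k (pderiv (Sum.inl j) (F' (Sum.inr k)) +
      C (θ : ℂ) * pderiv (Sum.inr k) (F' (Sum.inl j))) = 0 := by
  have hs := restrictDiag_cross_stepRest hD j k hF
  rw [step_inl j k hF', step_inr j k (dividedDiff_symm hD (by simp)) hF', ← stepRest, ← stepRest]
  simp only [map_sub, map_neg, pderiv_C, pderiv_mul, map_add, map_mul, restrictDiag_C,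
    pderiv_X_self, pderiv_X_of_ne (inr_ne_inl' j k), pderiv_X_of_ne (inr_ne_inl' j k).symm,
    restrictDiag_X_inl, restrictDiag_X_of_ne (inr_ne_inl' j k), map_zero, map_one]
  have h2 := C_half_mul_two (n := n) (m := m)
  have r1 := restrictDiag_pderiv_pderiv_sub hD j k
  rw [pderiv_pderiv_comm (Sum.inr k) (Sum.inl j)]
  linear_combination C (θ : ℂ) * X (Sum.inr k) * r1 - C (1 / 2) * hs +
    C (θ : ℂ) * X (Sum.inr k) *
      (restrictDiag j k (pderiv (Sum.inl j) (D (Sum.inl j) (Sum.inr k))) -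
        restrictDiag j k (pderiv (Sum.inr k) (D (Sum.inl j) (Sum.inr k)))) * h2

theorem step_restrict_quasiDeriv {l : Idx n m} (h1 : l ≠ Sum.inl j) (h2 : l ≠ Sum.inr k) :
    restrictDiag j k (quasiDeriv θ j k (F' l)) = 0 := by
  have hz : (Sum.inl j : Idx n m) ∈ Finset.univ.erase l := by simp [h1.symm]
  have hw : (Sum.inr k : Idx n m) ∈ (Finset.univ.erase l).erase (Sum.inl j) := by simp [h2.symm]
  have hzw := inr_ne_inl' j k
  have hquasi : ∀ i, i ≠ Sum.inl j → i ≠ Sum.inr k →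
      restrictDiag j k (pderiv (Sum.inl j) (F i)) +
        C (θ : ℂ) * restrictDiag j k (pderiv (Sum.inr k) (F i)) = 0 := by
    intro i hi1 hi2
    have h := hF.restrict_quasiDeriv j k i hi1 hi2
    rwa [quasiDeriv_apply, map_add, map_mul, restrictDiag_C] at h
  -- the leading term
  have hlead : restrictDiag j k (pderiv (Sum.inl j) (pderiv l (F l))) +
      C (θ : ℂ) * restrictDiag j k (pderiv (Sum.inr k) (pderiv l (F l))) = 0 := by
    have h := restrictDiag_pderiv_of_restrictDiag_eq_zero h1 h2
      (hF.restrict_quasiDeriv j k l h1 h2)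
    rwa [quasiDeriv_apply, map_add, pderiv_C_mul, map_add, map_mul, restrictDiag_C,
      pderiv_pderiv_comm l, pderiv_pderiv_comm l] at h
  -- the terms away from `z_j` and `w_k`
  have hrest : ∀ i, i ≠ l → i ≠ Sum.inl j → i ≠ Sum.inr k →
      restrictDiag j k (pderiv (Sum.inl j) (D l i)) +
        C (θ : ℂ) * restrictDiag j k (pderiv (Sum.inr k) (D l i)) = 0 := by
    intro i hil hi1 hi2
    apply mul_left_cancel₀ (X_sub_X_ne_zero (R := ℂ) hil.symm)
    have e1 := congrArg (fun p => restrictDiag j k (pderiv (Sum.inl j) p)) (hD l i)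
    have e2 := congrArg (fun p => restrictDiag j k (pderiv (Sum.inr k) p)) (hD l i)
    simp only [pderiv_mul, map_sub, map_add, map_mul, pderiv_X_of_ne h1, pderiv_X_of_ne h2,
      pderiv_X_of_ne hi1, pderiv_X_of_ne hi2, restrictDiag_X_of_ne h1, restrictDiag_X_of_ne hi1,
      map_zero] at e1 e2
    linear_combination -e1 - C (θ : ℂ) * e2 + hquasi l h1 h2 - hquasi i hi1 hi2
  -- the terms at `z_j` and `w_k`
  have hD1 : restrictDiag j k (D l (Sum.inl j)) = restrictDiag j k (D l (Sum.inr k)) := by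
    rw [dividedDiff_symm hD h1, dividedDiff_symm hD h2,
      restrictDiag_dividedDiff_eq hD j k hF h1 h2]
  -- Only this combination of the two divided differences, with the recursion weights `-θ` and `1`,
  -- has to vanish: times `x_l - w_k` it reduces to `θ - 1` times the crossed relation.
  have hpair : -C (θ : ℂ) * (restrictDiag j k (pderiv (Sum.inl j) (D l (Sum.inl j))) +
        C (θ : ℂ) * restrictDiag j k (pderiv (Sum.inr k) (D l (Sum.inl j)))) +
      (restrictDiag j k (pderiv (Sum.inl j) (D l (Sum.inr k))) +
        C (θ : ℂ) * restrictDiag j k (pderiv (Sum.inr k) (D l (Sum.inr k)))) = 0 := by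
    apply mul_left_cancel₀ (X_sub_X_ne_zero (R := ℂ) h2)
    have e1 := congrArg (fun p => restrictDiag j k (pderiv (Sum.inl j) p)) (hD l (Sum.inl j))
    have e2 := congrArg (fun p => restrictDiag j k (pderiv (Sum.inr k) p)) (hD l (Sum.inl j))
    have e3 := congrArg (fun p => restrictDiag j k (pderiv (Sum.inl j) p)) (hD l (Sum.inr k))
    have e4 := congrArg (fun p => restrictDiag j k (pderiv (Sum.inr k) p)) (hD l (Sum.inr k))
    simp only [pderiv_mul, map_sub, map_add, map_mul, pderiv_X_of_ne h1, pderiv_X_of_ne h2,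
      pderiv_X_self, pderiv_X_of_ne hzw, pderiv_X_of_ne hzw.symm, restrictDiag_X_of_ne h1,
      restrictDiag_X_inl, restrictDiag_X_of_ne hzw, map_zero, map_one] at e1 e2 e3 e4
    have r1 := restrictDiag_pderiv_inl_sub hD j k
    have r2 := restrictDiag_pderiv_inr_sub hD j k
    have r3 := restrictDiag_cross_eq j k hF
    have r4 := hquasi l h1 h2
    linear_combination C (θ : ℂ) * e1 + C (θ : ℂ) ^ 2 * e2 - e3 - C (θ : ℂ) * e4 +
      (1 - C (θ : ℂ)) * r4 + C (θ : ℂ) * r1 + C (θ : ℂ) * r2 + (C (θ : ℂ) - 1) * r3 -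
      C (θ : ℂ) * hD1
  have hs : restrictDiag j k (quasiDeriv θ j k (∑ i ∈ ((Finset.univ.erase l).erase
      (Sum.inl j)).erase (Sum.inr k), C ((-(θ : ℂ)) ^ (1 - parity i)) *
        ((X l + X i) * D l i))) = 0 := by
    simp only [map_sum]
    refine Finset.sum_eq_zero fun i hi => ?_
    simp only [Finset.mem_erase, Finset.mem_univ, and_true] at hi
    simp only [quasiDeriv_apply, pderiv_C, pderiv_mul, map_mul, map_add, restrictDiag_C,
      restrictDiag_X_of_ne h1, restrictDiag_X_of_ne hi.2.1, pderiv_X_of_ne h1, pderiv_X_of_ne h2,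
      pderiv_X_of_ne hi.1, pderiv_X_of_ne hi.2.1, map_zero]
    linear_combination C ((-(θ : ℂ)) ^ (1 - parity i)) * (X l + X i) * hrest i hi.2.2 hi.2.1 hi.1
  rw [hF', ← Finset.add_sum_erase _ _ hz, ← Finset.add_sum_erase _ _ hw, parity_inl, parity_inr]
  set S := ∑ i ∈ ((Finset.univ.erase l).erase
      (Sum.inl j)).erase (Sum.inr k), C ((-(θ : ℂ)) ^ (1 - parity i)) * ((X l + X i) * D l i)
  rw [quasiDeriv_apply, map_add, map_mul, restrictDiag_C] at hs ⊢
  simp only [map_sub, map_neg, pderiv_C, pderiv_one, pderiv_mul, map_add, map_mul, restrictDiag_C,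
    pderiv_X_self, pderiv_X_of_ne hzw, pderiv_X_of_ne hzw.symm, pderiv_X_of_ne h1,
    pderiv_X_of_ne h2, restrictDiag_X_inl, restrictDiag_X_of_ne hzw, restrictDiag_X_of_ne h1,
    map_zero, map_one, zpow_one, sub_zero, sub_self, zpow_zero]
  linear_combination C ((-(θ : ℂ)) ^ parity l) * X l * hlead - C (1 / 2) * hs -
    C (1 / 2) * (X l + X (Sum.inr k)) * hpair + C (1 / 2) * C (θ : ℂ) * hD1

end Step

theorem IsStep.isQuasiFamily {θ : ℝ} {F F' : Idx n m → Poly n m} (h : IsStep θ F F')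
    (hF : IsQuasiFamily θ F) : IsQuasiFamily θ F' := by
  have hr := h.rename_eq hF
  obtain ⟨D, hD, hF'⟩ := h
  exact ⟨hr, fun j k => step_restrict_eq hD j k hF hF',
    fun j k => step_restrict_cross hD j k hF hF',
    fun j k l h1 h2 => step_restrict_quasiDeriv hD j k hF hF' h1 h2⟩

/-- With weights `1` and `-1/θ`, the condition on `F_{z_j}` and `F_{w_k}` becomes `1 - 1/θ` times
the crossed relation, since the two divided differences that appear cancel. -/
theorem IsQuasiFamily.sum_mem {θ : ℝ} (hθ : θ ≠ 0) {F : Idx n m → Poly n m}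
    (hF : IsQuasiFamily θ F) :
    ∑ i, C ((-(θ : ℂ)) ^ (-parity i)) * F i ∈ quasiInvariants n m θ := by
  refine ⟨fun σ τ => ?_, fun j k => ?_⟩
  · rw [map_sum]
    refine Fintype.sum_equiv (Equiv.sumCongr σ τ) _ _ fun i => ?_
    rw [map_mul, rename_C, hF.rename_eq, ← parity_sumMap σ τ i]
    rfl
  · have hθ' : (C (θ : ℂ) : Poly n m) ≠ 0 := by simpa using hθ
    choose D hD using hF.dvd_sub
    have hz : (Sum.inl j : Idx n m) ∈ Finset.univ := Finset.mem_univ _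
    have hw : (Sum.inr k : Idx n m) ∈ Finset.univ.erase (Sum.inl j) := by simp
    have hs : restrictDiag j k (quasiDeriv θ j k (∑ i ∈ (Finset.univ.erase
        (Sum.inl j)).erase (Sum.inr k), C ((-(θ : ℂ)) ^ (-parity i)) * F i)) = 0 := by
      simp only [map_sum]
      refine Finset.sum_eq_zero fun i hi => ?_
      simp only [Finset.mem_erase, Finset.mem_univ, and_true] at hi
      rw [← smul_eq_C_mul, Derivation.map_smul, map_smul,
        hF.restrict_quasiDeriv j k i hi.2 hi.1, smul_zero]
    rw [← Finset.add_sum_erase _ _ hz, ← Finset.add_sum_erase _ _ hw, parity_inl, parity_inr]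
    simp only [map_add, hs, add_zero]
    simp only [quasiDeriv_apply, pderiv_C_mul, map_add, map_mul, restrictDiag_C]
    have r1 := restrictDiag_pderiv_inl_sub hD j k
    have r2 := restrictDiag_pderiv_inr_sub hD j k
    have r3 := restrictDiag_cross_eq j k hF
    have hinv : (C ((-(θ : ℂ)) ^ (-1 : ℤ)) : Poly n m) * C (θ : ℂ) = -1 := by
      rw [← map_mul, zpow_neg_one, inv_neg, neg_mul, inv_mul_cancel₀ (by simpa using hθ), map_neg,
        map_one]
    simp only [neg_zero, zpow_zero, map_one, one_mul]
    linear_combination (1 + C ((-(θ : ℂ)) ^ (-1 : ℤ))) * r3 + r1 + r2 +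
      (restrictDiag j k (pderiv (Sum.inr k) (F (Sum.inr k))) -
        restrictDiag j k (pderiv (Sum.inr k) (F (Sum.inl j)))) * hinv

/-! ### From polynomial families to the operators on rational functions -/

theorem IsStep.algebraMap_eq {θ : ℝ} {F F' : Idx n m → Poly n m} (h : IsStep θ F F')
    (i : Idx n m) :
    algebraMap (Poly n m) (RatFn n m) (F' i) =
      pdoOne θ i (algebraMap _ _ (F i)) - (1 / 2 : ℂ) • ∑ k ∈ Finset.univ.erase i,
        (-(θ : ℂ)) ^ (1 - parity k) • ((coord i + coord k) / (coord i - coord k) *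
          (algebraMap _ _ (F i) - algebraMap _ _ (F k))) := by
  obtain ⟨D, hD, hF'⟩ := h
  have hC : ∀ (c : ℂ) (p : Poly n m), algebraMap (Poly n m) (RatFn n m) (C c * p) =
      c • algebraMap (Poly n m) (RatFn n m) p := by
    intro c p
    rw [← smul_eq_C_mul, Algebra.smul_def, Algebra.smul_def, map_mul,
      ← IsScalarTower.algebraMap_apply]
  rw [hF', map_sub, hC, hC, map_sum]
  congr 1
  · rw [map_mul, pdoOne, LinearMap.smul_apply, LinearMap.comp_apply, LinearMap.mulLeft_apply]
    congr 2
    exact (fracDeriv_algebraMap _ _).symm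
  · congr 1
    refine Finset.sum_congr rfl fun k hk => ?_
    rw [hC, ← map_sub, hD, map_mul, map_mul, map_add, map_sub]
    have hne : coord i - coord k ≠ (0 : RatFn n m) := by
      rw [coord, coord, ← map_sub]
      exact (map_ne_zero_iff _ (IsFractionRing.injective _ _)).2
        (X_sub_X_ne_zero (Finset.ne_of_mem_erase hk).symm)
    rw [← coord, ← coord, ← mul_assoc, div_mul_cancel₀ _ hne]

theorem pdo_algebraMap {θ : ℝ} {p : Poly n m} {F : ℕ → Idx n m → Poly n m}
    (h0 : F 0 = fun _ => p) (hF : ∀ r, IsStep θ (F r) (F (r + 1))) (r : ℕ) (i : Idx n m) :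
    pdo θ r i (algebraMap _ _ p) = algebraMap (Poly n m) (RatFn n m) (F r i) := by
  induction r generalizing i with
  | zero => rw [h0]; rfl
  | succ r ih =>
    rw [(hF r).algebraMap_eq i]
    rcases r with _ | r
    -- The chain starts at the constant family, whose differences vanish, so its first step is
    -- `∂^{(1)}` alone, although `pdo` does not obtain its value at 1 from the recursion.
    · simp [pdo, h0]
    · simp only [pdo, LinearMap.sub_apply, LinearMap.smul_apply, LinearMap.comp_apply, ih,
        LinearMap.sum_apply, LinearMap.mulLeft_apply]

theorem exists_stepChain {θ : ℝ} {p : Poly n m} (hp : p ∈ quasiInvariants n m θ) :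
    ∃ F : ℕ → Idx n m → Poly n m, (F 0 = fun _ => p) ∧ (∀ r, IsStep θ (F r) (F (r + 1))) ∧
      ∀ r, IsQuasiFamily θ (F r) := by
  have h : ∀ F : {F : Idx n m → Poly n m // IsQuasiFamily θ F},
      ∃ F' : {F : Idx n m → Poly n m // IsQuasiFamily θ F}, IsStep θ F.1 F'.1 := by
    rintro ⟨F, hF⟩
    obtain ⟨F', hF'⟩ := hF.exists_isStep
    exact ⟨⟨F', hF'.isQuasiFamily hF⟩, hF'⟩
  choose s hs using h
  refine ⟨fun r => (s^[r] ⟨fun _ => p, isQuasiFamily_const hp⟩).1, rfl, fun r => ?_,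
    fun r => Subtype.property _⟩
  simp only [Function.iterate_succ_apply']
  exact hs _

theorem quantumIntegral_algebraMap {θ : ℝ} {p : Poly n m} {F : ℕ → Idx n m → Poly n m}
    (h0 : F 0 = fun _ => p) (hF : ∀ r, IsStep θ (F r) (F (r + 1))) (r : ℕ) :
    quantumIntegral n m θ r (algebraMap _ _ p) = algebraMap (Poly n m) (RatFn n m)
      (∑ i, C ((-(θ : ℂ)) ^ (-parity i)) * F r i) := by
  rw [quantumIntegral, LinearMap.sum_apply, map_sum]
  refine Finset.sum_congr rfl fun i _ => ?_
  rw [LinearMap.smul_apply, pdo_algebraMap h0 hF, ← smul_eq_C_mul, Algebra.smul_def,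
    Algebra.smul_def, map_mul, ← IsScalarTower.algebraMap_apply]

theorem exists_linearMap_quasiInvariants {θ : ℝ} (hθ : θ ≠ 0) (r : ℕ) :
    ∃ L : quasiInvariants n m θ →ₗ[ℂ] quasiInvariants n m θ, ∀ p : quasiInvariants n m θ,
      algebraMap (Poly n m) (RatFn n m) (L p) =
        quantumIntegral n m θ r (algebraMap (Poly n m) (RatFn n m) p) := by
  have inj : Function.Injective (algebraMap (Poly n m) (RatFn n m)) :=
    IsFractionRing.injective _ _
  have h : ∀ p : quasiInvariants n m θ, ∃ q : quasiInvariants n m θ,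
      algebraMap (Poly n m) (RatFn n m) q =
        quantumIntegral n m θ r (algebraMap (Poly n m) (RatFn n m) p) := by
    intro p
    obtain ⟨F, h0, hF, hq⟩ := exists_stepChain p.2
    exact ⟨⟨_, (hq r).sum_mem hθ⟩, (quantumIntegral_algebraMap h0 hF r).symm⟩
  have hsmul : ∀ (c : ℂ) (p : Poly n m), algebraMap (Poly n m) (RatFn n m) (c • p) =
      c • algebraMap (Poly n m) (RatFn n m) p := by
    intro c p
    rw [Algebra.smul_def, Algebra.smul_def, map_mul, ← IsScalarTower.algebraMap_apply]
  choose L hL using h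
  refine ⟨⟨⟨L, fun p q => ?_⟩, fun c p => ?_⟩, hL⟩
  · apply Subtype.ext
    apply inj
    rw [Subalgebra.coe_add, map_add, hL, hL, hL, Subalgebra.coe_add, map_add, map_add]
  · apply Subtype.ext
    apply inj
    change algebraMap (Poly n m) (RatFn n m) (L (c • p)) =
      algebraMap (Poly n m) (RatFn n m) (c • (L p : Poly n m))
    rw [hsmul, hL, hL, Subalgebra.coe_smul, hsmul, map_smul]

/-! ### Integration over a product of angle intervals -/

/-- Lebesgue measure on the angle interval `[0, 2π]`. -/
def angleMeasure : MeasureTheory.Measure ℝ :=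
  MeasureTheory.volume.restrict (Set.Icc 0 (2 * Real.pi))

instance : MeasureTheory.IsFiniteMeasure angleMeasure := by
  unfold angleMeasure; infer_instance

section Angles

variable {ι : Type*} [Fintype ι]

/-- Lebesgue measure on the cube of angles `[0, 2π]^ι`. -/
def anglesMeasure (ι : Type*) [Fintype ι] : MeasureTheory.Measure (ι → ℝ) :=
  MeasureTheory.Measure.pi fun _ => angleMeasure

instance : MeasureTheory.IsFiniteMeasure (anglesMeasure ι) := by
  unfold anglesMeasure; infer_instance

theorem anglesMeasure_eq_restrict :
    anglesMeasure ι = MeasureTheory.volume.restrict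
      (Set.Icc (0 : ι → ℝ) fun _ => 2 * Real.pi) := by
  rw [← Set.pi_univ_Icc, MeasureTheory.volume_pi, MeasureTheory.Measure.restrict_pi_pi]
  rfl

theorem integrable_anglesMeasure {f : (ι → ℝ) → ℂ} (hf : Continuous f) :
    MeasureTheory.Integrable f (anglesMeasure ι) := by
  rw [anglesMeasure_eq_restrict]
  exact hf.continuousOn.integrableOn_compact isCompact_Icc

theorem integral_pi_subtype_of_unique (p : ι → Prop) [DecidablePred p] [Unique (Subtype p)]
    (μ : MeasureTheory.Measure ℝ)
    [MeasureTheory.SigmaFinite μ] (g : (Subtype p → ℝ) → ℂ) :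
    ∫ a, g a ∂(MeasureTheory.Measure.pi fun _ : Subtype p => μ) = ∫ s, g (fun _ => s) ∂μ := by
  have e := (MeasureTheory.measurePreserving_piUnique fun _ : Subtype p => μ).symm
  rw [← e.integral_comp (MeasurableEquiv.measurableEmbedding _)]
  rfl

/-- Fubini, with the `i`-th angle integrated first. -/
theorem integral_anglesMeasure_eq_zero [DecidableEq ι] (i : ι) {f : (ι → ℝ) → ℂ}
    (hf : Continuous f) (h : ∀ t, ∫ s, f (Function.update t i s) ∂angleMeasure = 0) :
    ∫ t, f t ∂anglesMeasure ι = 0 := by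
  have hint := integrable_anglesMeasure hf
  have e1 := (MeasureTheory.measurePreserving_piEquivPiSubtypeProd
    (fun _ : ι => angleMeasure) (fun x => x = i)).symm
  set E := (MeasurableEquiv.piEquivPiSubtypeProd (fun _ : ι => ℝ) (fun x => x = i)).symm with hE
  rw [anglesMeasure, ← e1.integral_comp E.measurableEmbedding]
  have hint' : MeasureTheory.Integrable (fun x => f (E x)) _ :=
    (e1.integrable_comp_emb E.measurableEmbedding).2 hint
  rw [MeasureTheory.integral_prod_symm _ hint']
  refine MeasureTheory.integral_eq_zero_of_ae (Filter.Eventually.of_forall fun b => ?_)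
  simp only [Pi.zero_apply]
  have : Unique (Subtype fun x : ι => x = i) := Unique.subtypeEq i
  refine (integral_pi_subtype_of_unique (fun x => x = i) angleMeasure _).trans ?_
  -- The value 0 at coordinate `i` is a dummy, overwritten by `Function.update`.
  rw [← h (E (fun _ => 0, b))]
  refine MeasureTheory.integral_congr_ae (Filter.Eventually.of_forall fun s => ?_)
  change f _ = f _
  congr 1
  funext x
  by_cases hx : x = i
  · subst hx
    simp [hE, MeasurableEquiv.piEquivPiSubtypeProd, Equiv.piEquivPiSubtypeProd]
  · simp [hE, MeasurableEquiv.piEquivPiSubtypeProd, Equiv.piEquivPiSubtypeProd, hx]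

/-- The fundamental theorem of calculus over one full period. -/
theorem integral_anglesMeasure_deriv_eq_zero [DecidableEq ι] (i : ι) {f f' : (ι → ℝ) → ℂ}
    (hf' : Continuous f')
    (h : ∀ t, HasDerivAt (fun s => f (Function.update t i s)) (f' t) (t i))
    (hper : ∀ t, f (Function.update t i (t i + 2 * Real.pi)) = f t) :
    ∫ t, f' t ∂anglesMeasure ι = 0 := by
  refine integral_anglesMeasure_eq_zero i hf' fun t => ?_
  rw [angleMeasure, MeasureTheory.integral_Icc_eq_integral_Ioc,
    ← intervalIntegral.integral_of_le (by positivity)]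
  have hd : ∀ s, HasDerivAt (fun s => f (Function.update t i s))
      (f' (Function.update t i s)) s := by
    intro s
    have := h (Function.update t i s)
    simpa using this
  rw [intervalIntegral.integral_eq_sub_of_hasDerivAt (fun s _ => hd s)]
  · have := hper (Function.update t i 0)
    simp only [Function.update_self, Function.update_idem, zero_add] at this
    rw [this, sub_self]
  · apply Continuous.intervalIntegrable
    exact hf'.comp (continuous_const.update i continuous_id)

theorem integral_anglesMeasure_sum {f : (Fin n ⊕ Fin m → ℝ) → ℂ} (hf : Continuous f) :
    ∫ t, ∫ u, f (Sum.elim t u) ∂anglesMeasure (Fin m) ∂anglesMeasure (Fin n) =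
      ∫ t, f t ∂anglesMeasure (Fin n ⊕ Fin m) := by
  have hint := integrable_anglesMeasure hf
  have e1 := MeasureTheory.measurePreserving_sumPiEquivProdPi_symm
    (fun _ : Fin n ⊕ Fin m => angleMeasure)
  set E := (MeasurableEquiv.sumPiEquivProdPi fun _ : Fin n ⊕ Fin m => ℝ).symm with hE
  have hint' : MeasureTheory.Integrable (fun x => f (E x)) _ :=
    (e1.integrable_comp_emb E.measurableEmbedding).2 hint
  rw [anglesMeasure, anglesMeasure, anglesMeasure, ← e1.integral_comp E.measurableEmbedding,
    MeasureTheory.integral_prod _ hint']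
  refine MeasureTheory.integral_congr_ae (Filter.Eventually.of_forall fun t => ?_)
  refine MeasureTheory.integral_congr_ae (Filter.Eventually.of_forall fun u => ?_)
  change f _ = f _
  congr 1

end Angles

/-- The Jacobian `∏ i z_j` cancels both `∏ z_j⁻¹` and the power of `i` in the normalization. -/
theorem torusMean_eq {N : ℕ} {ξ : ℝ} (hξ : 0 < ξ) (f : (Fin N → ℂ) → ℂ) :
    torusMean ξ f = (1 / (2 * Real.pi) ^ N : ℂ) *
      ∫ t, f (torusMap 0 (fun _ => ξ) t) ∂anglesMeasure (Fin N) := by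
  have hpi : (Real.pi : ℂ) ≠ 0 := Complex.ofReal_ne_zero.2 Real.pi_ne_zero
  have hξ' : (ξ : ℂ) ≠ 0 := Complex.ofReal_ne_zero.2 hξ.ne'
  rw [torusMean, torusIntegral, anglesMeasure_eq_restrict, ← MeasureTheory.integral_const_mul,
    ← MeasureTheory.integral_const_mul]
  refine MeasureTheory.integral_congr_ae (Filter.Eventually.of_forall fun t => ?_)
  have hne : ∏ j, torusMap 0 (fun _ => ξ) t j ≠ 0 := by
    rw [Finset.prod_ne_zero_iff]
    intro j _
    simp [torusMap, hξ']
  have e : ∏ j, ((ξ : ℂ) * Complex.exp (t j * Complex.I) * Complex.I) =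
      (∏ j, torusMap 0 (fun _ => ξ) t j) * Complex.I ^ N := by
    rw [Finset.prod_mul_distrib]
    simp [torusMap]
  simp only [smul_eq_mul]
  rw [e, mul_pow]
  have hI : Complex.I ^ N ≠ 0 := pow_ne_zero _ Complex.I_ne_zero
  have h2 : (2 * Real.pi : ℂ) ^ N ≠ 0 := pow_ne_zero _ (mul_ne_zero two_ne_zero hpi)
  field_simp

/-! ### Integration by parts against a product over pairs -/

/-- Writing each derivative as `f * l` avoids dividing by factors that may vanish. -/
theorem hasDerivAt_prod_of_logDeriv {κ : Type*} (S : Finset κ) {f : κ → ℝ → ℂ} {l : κ → ℂ}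
    {x : ℝ} (h : ∀ a ∈ S, HasDerivAt (f a) (f a x * l a) x) :
    HasDerivAt (fun s => ∏ a ∈ S, f a s) ((∏ a ∈ S, f a x) * ∑ a ∈ S, l a) x := by
  classical
  induction S using Finset.induction_on with
  | empty => simpa using hasDerivAt_const x (1 : ℂ)
  | insert a S ha ih =>
    simp only [Finset.prod_insert ha, Finset.sum_insert ha]
    have h1 := h a (Finset.mem_insert_self a S)
    have h2 := ih fun b hb => h b (Finset.mem_insert_of_mem hb)
    refine HasDerivAt.congr_deriv (h1.mul h2) ?_
    ring

section Pairs

variable {ι : Type*} [Fintype ι] [DecidableEq ι]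

/-- The product over ordered pairs of distinct indices of functions of the angle differences. -/
def pairProd (Φ : ι → ι → ℝ → ℂ) (t : ι → ℝ) : ℂ :=
  ∏ a ∈ (Finset.univ : Finset ι).offDiag, Φ a.1 a.2 (t a.1 - t a.2)

omit [Fintype ι] in
theorem hasDerivAt_update_sub (t : ι → ℝ) (i j k : ι) :
    HasDerivAt (fun s => Function.update t i s j - Function.update t i s k)
      ((if j = i then 1 else 0) - (if k = i then 1 else 0)) (t i) := by
  have h : ∀ j, HasDerivAt (fun s => Function.update t i s j) (if j = i then 1 else 0) (t i) := by
    intro j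
    by_cases hj : j = i
    · subst hj
      simp only [Function.update_self, if_true]
      exact hasDerivAt_id' (t j)
    · simpa [Function.update_of_ne hj, hj] using hasDerivAt_const (t i) (t j)
  exact (h j).sub (h k)

theorem hasDerivAt_pairProd {Φ ψ : ι → ι → ℝ → ℂ}
    (hΦ : ∀ i k s, i ≠ k → HasDerivAt (Φ i k) (Φ i k s * ψ i k s) s) (t : ι → ℝ) (i : ι) :
    HasDerivAt (fun s => pairProd Φ (Function.update t i s))
      (pairProd Φ t * ∑ a ∈ (Finset.univ : Finset ι).offDiag, ψ a.1 a.2 (t a.1 - t a.2) *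
        ((if a.1 = i then 1 else 0) - (if a.2 = i then 1 else 0))) (t i) := by
  have h := hasDerivAt_prod_of_logDeriv (Finset.univ : Finset ι).offDiag (x := t i)
    (f := fun a s => Φ a.1 a.2 (Function.update t i s a.1 - Function.update t i s a.2))
    (l := fun a => ψ a.1 a.2 (t a.1 - t a.2) *
      ((if a.1 = i then 1 else 0) - (if a.2 = i then 1 else 0))) ?_
  · simpa only [Function.update_eq_self, pairProd] using h
  · intro a ha
    have h1 := hasDerivAt_update_sub t i a.1 a.2
    have h2 := hΦ a.1 a.2 (t a.1 - t a.2) (Finset.mem_offDiag.1 ha).2.2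
    have h3 : HasDerivAt (Φ a.1 a.2) (Φ a.1 a.2 (t a.1 - t a.2) * ψ a.1 a.2 (t a.1 - t a.2))
        (Function.update t i (t i) a.1 - Function.update t i (t i) a.2) := by
      simpa using h2
    refine HasDerivAt.congr_deriv (h3.scomp (t i) h1) ?_
    simp only [Function.update_eq_self, Complex.real_smul]
    split_ifs <;> simp

theorem pairProd_update_add_two_pi {Φ : ι → ι → ℝ → ℂ}
    (hΦ : ∀ i k, Function.Periodic (Φ i k) (2 * Real.pi)) (t : ι → ℝ) (i : ι) :
    pairProd Φ (Function.update t i (t i + 2 * Real.pi)) = pairProd Φ t := by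
  refine Finset.prod_congr rfl fun a ha => ?_
  have hne := (Finset.mem_offDiag.1 ha).2.2
  by_cases h1 : a.1 = i
  · rw [← h1, Function.update_self, Function.update_of_ne hne.symm, add_sub_right_comm]
    exact hΦ _ _ _
  · by_cases h2 : a.2 = i
    · rw [← h2, Function.update_self, Function.update_of_ne hne, ← sub_sub]
      exact (hΦ _ _).sub_eq _
    · rw [Function.update_of_ne h1, Function.update_of_ne h2]

omit [DecidableEq ι] in
theorem continuous_pairProd {Φ : ι → ι → ℝ → ℂ} (hΦ : ∀ i k, i ≠ k → Continuous (Φ i k)) :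
    Continuous (pairProd Φ) := by
  refine continuous_finsetProd _ fun a ha => ?_
  exact (hΦ a.1 a.2 (Finset.mem_offDiag.1 ha).2.2).comp
    ((continuous_apply a.1).sub (continuous_apply a.2))

/-- The sum over `i` of the vanishing integrals of `∂/∂t_i (P u_i)`. A pair factor depends only on
`t_i - t_k`, so its logarithmic derivative occurs with opposite signs at `i` and `k` and multiplies
`u_i - u_k`. -/
theorem integral_pairProd_mul_eq_zero {Φ ψ : ι → ι → ℝ → ℂ}
    (hΦ : ∀ i k s, i ≠ k → HasDerivAt (Φ i k) (Φ i k s * ψ i k s) s)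
    (hψ : ∀ i k, i ≠ k → Continuous (ψ i k))
    (hper : ∀ i k, Function.Periodic (Φ i k) (2 * Real.pi)) {u v : ι → (ι → ℝ) → ℂ}
    (hu : ∀ i, Continuous (u i)) (hv : ∀ i, Continuous (v i))
    (huv : ∀ i t, HasDerivAt (fun s => u i (Function.update t i s)) (v i t) (t i))
    (huper : ∀ i t, u i (Function.update t i (t i + 2 * Real.pi)) = u i t) :
    ∫ t, pairProd Φ t * (∑ i, v i t + ∑ a ∈ (Finset.univ : Finset ι).offDiag,
      ψ a.1 a.2 (t a.1 - t a.2) * (u a.1 t - u a.2 t)) ∂anglesMeasure ι = 0 := by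
  have hΦc : ∀ i k, i ≠ k → Continuous (Φ i k) := fun i k hik =>
    continuous_iff_continuousAt.2 fun s => (hΦ i k s hik).continuousAt
  have hP := continuous_pairProd hΦc
  have hψ' : ∀ a ∈ (Finset.univ : Finset ι).offDiag,
      Continuous fun t : ι → ℝ => ψ a.1 a.2 (t a.1 - t a.2) := fun a ha =>
    (hψ a.1 a.2 (Finset.mem_offDiag.1 ha).2.2).comp
      ((continuous_apply a.1).sub (continuous_apply a.2))
  set w : ι → (ι → ℝ) → ℂ := fun i t =>
    pairProd Φ t * (∑ a ∈ (Finset.univ : Finset ι).offDiag, ψ a.1 a.2 (t a.1 - t a.2) *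
        ((if a.1 = i then 1 else 0) - (if a.2 = i then 1 else 0))) * u i t +
      pairProd Φ t * v i t with hw
  have hwc : ∀ i, Continuous (w i) := by
    intro i
    refine ((hP.mul (continuous_finsetSum _ fun a ha => ?_)).mul (hu i)).add (hP.mul (hv i))
    exact (hψ' a ha).mul continuous_const
  have hzero : ∀ i, ∫ t, w i t ∂anglesMeasure ι = 0 := by
    intro i
    refine integral_anglesMeasure_deriv_eq_zero i (f := fun t => pairProd Φ t * u i t) (hwc i)
      (fun t => ?_) fun t => ?_
    · have h := (hasDerivAt_pairProd hΦ t i).mul (huv i t)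
      simp only [Function.update_eq_self] at h
      exact h
    · simp only [pairProd_update_add_two_pi hper, huper]
  have hsum : ∀ t, pairProd Φ t * (∑ i, v i t + ∑ a ∈ (Finset.univ : Finset ι).offDiag,
      ψ a.1 a.2 (t a.1 - t a.2) * (u a.1 t - u a.2 t)) = ∑ i, w i t := by
    intro t
    simp only [hw, Finset.sum_add_distrib, ← Finset.mul_sum, mul_assoc]
    rw [← mul_add, add_comm]
    congr 2
    simp only [Finset.sum_mul]
    rw [Finset.sum_comm]
    refine Finset.sum_congr rfl fun a _ => ?_
    simp [mul_assoc, ← Finset.mul_sum, sub_mul]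
  simp only [hsum]
  rw [MeasureTheory.integral_finsetSum _ fun i _ => integrable_anglesMeasure (hwc i)]
  exact Finset.sum_eq_zero fun i _ => hzero i

end Pairs

/-! ### The regularized weight -/

/-- The squared chord length `|1 - e^{is}|²`. -/
def chordSq (s : ℝ) : ℝ := 2 - 2 * Real.cos s

theorem chordSq_nonneg (s : ℝ) : 0 ≤ chordSq s := by
  have := Real.cos_le_one s
  unfold chordSq; linarith

theorem continuous_chordSq : Continuous chordSq := by
  unfold chordSq; fun_prop

theorem hasDerivAt_chordSq (s : ℝ) : HasDerivAt chordSq (2 * Real.sin s) s := by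
  refine HasDerivAt.congr_deriv (((Real.hasDerivAt_cos s).const_mul 2).const_sub 2) ?_
  ring

/-- The regularized power `(|1 - e^{is}|² + ε)^γ`. -/
def regPow (γ ε s : ℝ) : ℂ := ((chordSq s + ε) ^ γ : ℝ)

/-- Its logarithmic derivative. -/
def regPowLog (γ ε s : ℝ) : ℂ := (γ * (2 * Real.sin s) / (chordSq s + ε) : ℝ)

/-- The damping factor `|1 - e^{is}|² / (|1 - e^{is}|² + ε)`. -/
def damping (ε s : ℝ) : ℂ := (chordSq s / (chordSq s + ε) : ℝ)

theorem hasDerivAt_regPow {ε : ℝ} (hε : 0 < ε) (γ s : ℝ) :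
    HasDerivAt (regPow γ ε) (regPow γ ε s * regPowLog γ ε s) s := by
  have hpos : 0 < chordSq s + ε := add_pos_of_nonneg_of_pos (chordSq_nonneg s) hε
  have h := (((hasDerivAt_chordSq s).add_const ε).rpow_const (p := γ)
    (Or.inl hpos.ne')).ofReal_comp
  refine HasDerivAt.congr_deriv h ?_
  rw [regPow, regPowLog, ← Complex.ofReal_mul, Real.rpow_sub_one hpos.ne']
  congr 1
  field_simp

theorem continuous_regPowLog {ε : ℝ} (hε : 0 < ε) (γ : ℝ) : Continuous (regPowLog γ ε) := by
  have := continuous_chordSq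
  unfold regPowLog
  refine Complex.continuous_ofReal.comp (Continuous.div (by fun_prop) (by fun_prop) fun s => ?_)
  exact (add_pos_of_nonneg_of_pos (chordSq_nonneg s) hε).ne'

theorem continuous_damping {ε : ℝ} (hε : 0 < ε) : Continuous (damping ε) := by
  have := continuous_chordSq
  unfold damping
  refine Complex.continuous_ofReal.comp (Continuous.div (by fun_prop) (by fun_prop) fun s => ?_)
  exact (add_pos_of_nonneg_of_pos (chordSq_nonneg s) hε).ne'

theorem continuous_regPow {γ : ℝ} (hγ : 0 ≤ γ) (ε : ℝ) : Continuous (regPow γ ε) := by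
  have := continuous_chordSq
  unfold regPow
  exact Complex.continuous_ofReal.comp ((this.add continuous_const).rpow_const fun s => Or.inr hγ)

theorem periodic_regPow (γ ε : ℝ) : Function.Periodic (regPow γ ε) (2 * Real.pi) := by
  intro s
  simp [regPow, chordSq]

theorem norm_damping_le {ε : ℝ} (hε : 0 < ε) (s : ℝ) : ‖damping ε s‖ ≤ 1 := by
  have h := chordSq_nonneg s
  rw [damping, Complex.norm_real, Real.norm_of_nonneg (by positivity)]
  exact div_le_one_of_le₀ (by linarith) (by positivity)

theorem norm_regPow_le {γ ε : ℝ} (hγ : 0 ≤ γ) (hε : 0 ≤ ε) (hε1 : ε ≤ 1) (s : ℝ) :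
    ‖regPow γ ε s‖ ≤ ‖regPow γ 1 s‖ := by
  have h := chordSq_nonneg s
  rw [regPow, regPow, Complex.norm_real, Complex.norm_real,
    Real.norm_of_nonneg (by positivity), Real.norm_of_nonneg (by positivity)]
  exact Real.rpow_le_rpow (by positivity) (by linarith) hγ

theorem tendsto_regPow {γ : ℝ} (hγ : 0 < γ) (s : ℝ) :
    Filter.Tendsto (fun ε => regPow γ ε s) (nhdsWithin 0 (Set.Ioi 0)) (nhds (regPow γ 0 s)) := by
  refine Filter.Tendsto.mono_left ?_ nhdsWithin_le_nhds
  have : Continuous fun ε => regPow γ ε s := by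
    unfold regPow
    exact Complex.continuous_ofReal.comp
      ((continuous_const.add continuous_id).rpow_const fun s => Or.inr hγ.le)
  exact this.tendsto 0

/-- At a coincidence the damping factor is 0 for every `ε > 0` and does not tend to 1; the limit
still holds because the power itself vanishes there when `γ > 0`. -/
theorem tendsto_regPow_mul_damping {γ : ℝ} (hγ : 0 < γ) (s : ℝ) :
    Filter.Tendsto (fun ε => regPow γ ε s * damping ε s) (nhdsWithin 0 (Set.Ioi 0))
      (nhds (regPow γ 0 s)) := by
  by_cases h : chordSq s = 0
  · simp [regPow, damping, h, Real.zero_rpow hγ.ne']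
  · have h1 : Filter.Tendsto (fun ε => damping ε s) (nhdsWithin 0 (Set.Ioi 0)) (nhds 1) := by
      refine Filter.Tendsto.mono_left ?_ nhdsWithin_le_nhds
      have : ContinuousAt (fun ε => damping ε s) 0 := by
        unfold damping
        refine Complex.continuous_ofReal.continuousAt.comp
          (continuousAt_const.div (by fun_prop) (by simpa using h))
      simpa [ContinuousAt, damping, div_self h] using this
    simpa using (tendsto_regPow hγ s).mul h1

/-- The factor `((1 - ρ e^{is}) (1 - 1 / (ρ e^{is})))⁻¹` of the weight coupling `z` and `w`. -/
def crossFactor (ρ s : ℝ) : ℂ :=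
  ((1 - ρ * Complex.exp (s * Complex.I)) * (1 - (ρ * Complex.exp (s * Complex.I))⁻¹))⁻¹

/-- Its logarithmic derivative. -/
def crossFactorLog (ρ s : ℝ) : ℂ :=
  -Complex.I * ((ρ * Complex.exp (s * Complex.I) + 1) / (ρ * Complex.exp (s * Complex.I) - 1))

theorem norm_mul_exp {ρ : ℝ} (hρ : 0 < ρ) (s : ℝ) : ‖(ρ : ℂ) * Complex.exp (s * Complex.I)‖ = ρ := by
  rw [norm_mul, Complex.norm_exp_ofReal_mul_I, mul_one, Complex.norm_real,
    Real.norm_of_nonneg hρ.le]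

theorem mul_exp_sub_one_ne_zero {ρ : ℝ} (hρ : 0 < ρ) (hρ1 : ρ < 1) (s : ℝ) :
    (ρ : ℂ) * Complex.exp (s * Complex.I) - 1 ≠ 0 := by
  intro h
  have := norm_mul_exp hρ s
  rw [sub_eq_zero.1 h, norm_one] at this
  exact hρ1.ne this.symm

theorem hasDerivAt_mul_exp (ρ : ℂ) (s : ℝ) :
    HasDerivAt (fun s : ℝ => ρ * Complex.exp (s * Complex.I))
      (Complex.I * (ρ * Complex.exp (s * Complex.I))) s := by
  have h : HasDerivAt (fun s : ℝ => (s : ℂ) * Complex.I) Complex.I s := by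
    simpa using (Complex.ofRealCLM.hasDerivAt (x := s)).mul_const Complex.I
  refine HasDerivAt.congr_deriv (h.cexp.const_mul ρ) ?_
  ring

theorem hasDerivAt_crossFactor {ρ : ℝ} (hρ : 0 < ρ) (hρ1 : ρ < 1) (s : ℝ) :
    HasDerivAt (crossFactor ρ) (crossFactor ρ s * crossFactorLog ρ s) s := by
  have h := hasDerivAt_mul_exp ρ s
  have h1 := mul_exp_sub_one_ne_zero hρ hρ1 s
  have h0 : (ρ : ℂ) * Complex.exp (s * Complex.I) ≠ 0 :=
    mul_ne_zero (Complex.ofReal_ne_zero.2 hρ.ne') (Complex.exp_ne_zero _)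
  have h2 : (1 - (ρ : ℂ) * Complex.exp (s * Complex.I)) *
      (1 - ((ρ : ℂ) * Complex.exp (s * Complex.I))⁻¹) ≠ 0 := by
    refine mul_ne_zero (fun e => h1 (by linear_combination -e)) fun e => h1 ?_
    rw [sub_eq_zero, eq_comm, inv_eq_one] at e
    rw [e, sub_self]
  refine HasDerivAt.congr_deriv (((h.const_sub 1).fun_mul ((h.fun_inv h0).const_sub 1)).fun_inv h2) ?_
  simp only [crossFactor, crossFactorLog]
  generalize (ρ : ℂ) * Complex.exp (s * Complex.I) = q at *
  have h3 : (1 - q) ≠ 0 := fun e => h1 (by linear_combination -e)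
  have h4 : (1 - q⁻¹) = (q - 1) / q := by field_simp
  simp only [h4]
  field_simp
  ring

theorem continuous_crossFactorLog {ρ : ℝ} (hρ : 0 < ρ) (hρ1 : ρ < 1) :
    Continuous (crossFactorLog ρ) := by
  unfold crossFactorLog
  exact continuous_const.mul (Continuous.div (by fun_prop) (by fun_prop)
    (mul_exp_sub_one_ne_zero hρ hρ1))

theorem periodic_exp_mul_I : Function.Periodic (fun s : ℝ => Complex.exp (s * Complex.I))
    (2 * Real.pi) := by
  intro s
  push_cast
  rw [add_mul, Complex.exp_add, Complex.exp_two_pi_mul_I, mul_one]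

theorem periodic_crossFactor (ρ : ℝ) : Function.Periodic (crossFactor ρ) (2 * Real.pi) := by
  intro s
  simp only [crossFactor, periodic_exp_mul_I s]

/-- The factor of the regularized weight attached to an ordered pair of distinct indices, as a
function of the angle difference. -/
def pairFactor (θ ρ ε : ℝ) : Idx n m → Idx n m → ℝ → ℂ
  | Sum.inl _, Sum.inl _ => regPow (θ / 2) ε
  | Sum.inr _, Sum.inr _ => regPow (1 / θ / 2) ε
  | Sum.inl _, Sum.inr _ => crossFactor ρ
  | Sum.inr _, Sum.inl _ => fun _ => 1

/-- The logarithmic derivative of `pairFactor`. -/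
def pairFactorLog (θ ρ ε : ℝ) : Idx n m → Idx n m → ℝ → ℂ
  | Sum.inl _, Sum.inl _ => regPowLog (θ / 2) ε
  | Sum.inr _, Sum.inr _ => regPowLog (1 / θ / 2) ε
  | Sum.inl _, Sum.inr _ => crossFactorLog ρ
  | Sum.inr _, Sum.inl _ => fun _ => 0

/-- The damping factor attached to an ordered pair of indices. -/
def pairDamping (ε : ℝ) : Idx n m → Idx n m → ℝ → ℂ
  | Sum.inl _, Sum.inl _ => damping ε
  | Sum.inr _, Sum.inr _ => damping ε
  | Sum.inl _, Sum.inr _ => fun _ => 1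
  | Sum.inr _, Sum.inl _ => fun _ => 1

section PairFactor

variable {θ ρ : ℝ}

theorem hasDerivAt_pairFactor (hρ : 0 < ρ) (hρ1 : ρ < 1) {ε : ℝ} (hε : 0 < ε) (i k : Idx n m)
    (s : ℝ) : HasDerivAt (pairFactor θ ρ ε i k)
      (pairFactor θ ρ ε i k s * pairFactorLog θ ρ ε i k s) s := by
  rcases i with i | i <;> rcases k with k | k
  · exact hasDerivAt_regPow hε _ s
  · exact hasDerivAt_crossFactor hρ hρ1 s
  · rw [pairFactorLog, mul_zero]
    exact hasDerivAt_const s (1 : ℂ)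
  · exact hasDerivAt_regPow hε _ s

theorem continuous_pairFactorLog (hρ : 0 < ρ) (hρ1 : ρ < 1) {ε : ℝ} (hε : 0 < ε)
    (i k : Idx n m) : Continuous (pairFactorLog θ ρ ε i k) := by
  rcases i with i | i <;> rcases k with k | k
  · exact continuous_regPowLog hε _
  · exact continuous_crossFactorLog hρ hρ1
  · exact continuous_const
  · exact continuous_regPowLog hε _

theorem continuous_pairDamping {ε : ℝ} (hε : 0 < ε)
    (i k : Idx n m) : Continuous (pairDamping ε i k) := by
  rcases i with i | i <;> rcases k with k | k
  · exact continuous_damping hε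
  · exact continuous_const
  · exact continuous_const
  · exact continuous_damping hε

theorem continuous_pairFactor (hθ : 0 < θ) (hρ : 0 < ρ) (hρ1 : ρ < 1) (ε : ℝ)
    (i k : Idx n m) : Continuous (pairFactor θ ρ ε i k) := by
  rcases i with i | i <;> rcases k with k | k
  · exact continuous_regPow (by positivity) _
  · exact continuous_iff_continuousAt.2 fun s => (hasDerivAt_crossFactor hρ hρ1 s).continuousAt
  · exact continuous_const
  · exact continuous_regPow (by positivity) _

theorem periodic_pairFactor (θ ρ ε : ℝ) (i k : Idx n m) :
    Function.Periodic (pairFactor θ ρ ε i k) (2 * Real.pi) := by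
  rcases i with i | i <;> rcases k with k | k
  · exact periodic_regPow _ _
  · exact periodic_crossFactor _
  · exact fun _ => rfl
  · exact periodic_regPow _ _

theorem norm_pairDamping_le {ε : ℝ} (hε : 0 < ε) (i k : Idx n m) (s : ℝ) :
    ‖pairDamping ε i k s‖ ≤ 1 := by
  rcases i with i | i <;> rcases k with k | k
  · exact norm_damping_le hε s
  · simp [pairDamping]
  · simp [pairDamping]
  · exact norm_damping_le hε s

theorem norm_pairFactor_le (hθ : 0 < θ) {ε : ℝ} (hε : 0 ≤ ε) (hε1 : ε ≤ 1) (i k : Idx n m)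
    (s : ℝ) : ‖pairFactor θ ρ ε i k s‖ ≤ ‖pairFactor θ ρ 1 i k s‖ := by
  rcases i with i | i <;> rcases k with k | k
  · exact norm_regPow_le (by positivity) hε hε1 s
  · exact le_rfl
  · exact le_rfl
  · exact norm_regPow_le (by positivity) hε hε1 s

theorem tendsto_pairFactor (hθ : 0 < θ) (i k : Idx n m) (s : ℝ) :
    Filter.Tendsto (fun ε => pairFactor θ ρ ε i k s) (nhdsWithin 0 (Set.Ioi 0))
      (nhds (pairFactor θ ρ 0 i k s)) := by
  rcases i with i | i <;> rcases k with k | k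
  · exact tendsto_regPow (by positivity) s
  · exact tendsto_const_nhds
  · exact tendsto_const_nhds
  · exact tendsto_regPow (by positivity) s

theorem tendsto_pairFactor_mul_pairDamping (hθ : 0 < θ) (i k : Idx n m) (s : ℝ) :
    Filter.Tendsto (fun ε => pairFactor θ ρ ε i k s * pairDamping ε i k s)
      (nhdsWithin 0 (Set.Ioi 0)) (nhds (pairFactor θ ρ 0 i k s)) := by
  rcases i with i | i <;> rcases k with k | k
  · exact tendsto_regPow_mul_damping (by positivity) s
  · simp [pairFactor, pairDamping]
  · simp [pairFactor, pairDamping]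
  · exact tendsto_regPow_mul_damping (by positivity) s

theorem tendsto_pairProd_mul (hθ : 0 < θ) (t : Idx n m → ℝ) (V : ℂ)
    (K : Idx n m → Idx n m → ℂ) :
    Filter.Tendsto (fun ε => pairProd (pairFactor θ ρ ε) t *
      (V + ∑ a ∈ (Finset.univ : Finset (Idx n m)).offDiag,
        pairDamping ε a.1 a.2 (t a.1 - t a.2) * K a.1 a.2)) (nhdsWithin 0 (Set.Ioi 0))
      (nhds (pairProd (pairFactor θ ρ 0) t *
        (V + ∑ a ∈ (Finset.univ : Finset (Idx n m)).offDiag, K a.1 a.2))) := by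
  simp only [mul_add, Finset.mul_sum]
  refine Filter.Tendsto.add (Filter.Tendsto.mul_const V ?_) (tendsto_finsetSum _ fun a ha => ?_)
  · exact tendsto_finsetProd _ fun a _ => tendsto_pairFactor hθ _ _ _
  · simp only [← mul_assoc]
    refine Filter.Tendsto.mul_const _ ?_
    -- Each damping factor is grouped with the weight factor of the same pair, since only their
    -- product is known to converge.
    simp only [pairProd, ← Finset.mul_prod_erase _ _ ha, mul_right_comm]
    exact (tendsto_pairFactor_mul_pairDamping hθ _ _ _).mul
      (tendsto_finsetProd _ fun b _ => tendsto_pairFactor hθ _ _ _)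

/-- The limiting case `ε → 0` of integration by parts against the regularized weight. -/
theorem integral_pairProd_zero_mul_eq_zero (hθ : 0 < θ) (hρ : 0 < ρ) (hρ1 : ρ < 1)
    {u v : Idx n m → (Idx n m → ℝ) → ℂ} {K : Idx n m → Idx n m → (Idx n m → ℝ) → ℂ}
    (hu : ∀ i, Continuous (u i)) (hv : ∀ i, Continuous (v i)) (hK : ∀ i k, Continuous (K i k))
    (huv : ∀ i t, HasDerivAt (fun s => u i (Function.update t i s)) (v i t) (t i))
    (huper : ∀ i t, u i (Function.update t i (t i + 2 * Real.pi)) = u i t)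
    (hK' : ∀ ε, 0 < ε → ∀ i k t, i ≠ k → pairFactorLog θ ρ ε i k (t i - t k) * (u i t - u k t) =
      pairDamping ε i k (t i - t k) * K i k t) :
    ∫ t, pairProd (pairFactor θ ρ 0) t * (∑ i, v i t +
      ∑ a ∈ (Finset.univ : Finset (Idx n m)).offDiag, K a.1 a.2 t) ∂anglesMeasure (Idx n m) = 0 := by
  set G : ℝ → (Idx n m → ℝ) → ℂ := fun ε t => pairProd (pairFactor θ ρ ε) t * (∑ i, v i t +
    ∑ a ∈ (Finset.univ : Finset (Idx n m)).offDiag,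
      pairDamping ε a.1 a.2 (t a.1 - t a.2) * K a.1 a.2 t) with hG
  have hGc : ∀ ε, 0 < ε → Continuous (G ε) := by
    intro ε hε
    refine (continuous_pairProd fun i k _ => continuous_pairFactor hθ hρ hρ1 ε i k).mul
      ((continuous_finsetSum _ fun i _ => hv i).add (continuous_finsetSum _ fun a _ => ?_))
    exact ((continuous_pairDamping hε a.1 a.2).comp
      ((continuous_apply a.1).sub (continuous_apply a.2))).mul (hK _ _)
  have hG0 : ∀ ε, 0 < ε → ∫ t, G ε t ∂anglesMeasure (Idx n m) = 0 := by
    intro ε hε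
    rw [← integral_pairProd_mul_eq_zero (Φ := pairFactor θ ρ ε) (ψ := pairFactorLog θ ρ ε)
      (fun i k s _ => hasDerivAt_pairFactor hρ hρ1 hε i k s)
      (fun i k _ => continuous_pairFactorLog hρ hρ1 hε i k)
      (periodic_pairFactor θ ρ ε) hu hv huv huper]
    refine MeasureTheory.integral_congr_ae (Filter.Eventually.of_forall fun t => ?_)
    simp only [hG]
    congr 2
    refine Finset.sum_congr rfl fun a ha => ?_
    exact (hK' ε hε a.1 a.2 t (Finset.mem_offDiag.1 ha).2.2).symm
  have hev : ∀ᶠ ε : ℝ in nhdsWithin 0 (Set.Ioi 0), 0 < ε ∧ ε ≤ 1 :=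
    (eventually_mem_nhdsWithin).and
      (Filter.Eventually.filter_mono nhdsWithin_le_nhds (Iic_mem_nhds one_pos))
  -- The value at `ε = 1` dominates: the regularized powers increase with `ε`, and the damping
  -- factors are at most 1.
  have hlim := MeasureTheory.tendsto_integral_filter_of_dominated_convergence
    (μ := anglesMeasure (Idx n m)) (l := nhdsWithin (0 : ℝ) (Set.Ioi 0)) (F := G)
    (f := fun t => pairProd (pairFactor θ ρ 0) t * (∑ i, v i t +
      ∑ a ∈ (Finset.univ : Finset (Idx n m)).offDiag, K a.1 a.2 t))
    (fun t => ‖pairProd (pairFactor θ ρ 1) t‖ * (‖∑ i, v i t‖ +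
      ∑ a ∈ (Finset.univ : Finset (Idx n m)).offDiag, ‖K a.1 a.2 t‖))
    (hev.mono fun ε hε => (hGc ε hε.1).aestronglyMeasurable)
    (hev.mono fun ε hε => Filter.Eventually.of_forall fun t => ?_) ?_
    (Filter.Eventually.of_forall fun t => tendsto_pairProd_mul hθ t _ fun i k => K i k t)
  · refine tendsto_nhds_unique hlim (Filter.Tendsto.congr' ?_ tendsto_const_nhds)
    exact hev.mono fun ε hε => (hG0 ε hε.1).symm
  · rw [hG, norm_mul]
    refine mul_le_mul ?_ ?_ (norm_nonneg _) (norm_nonneg _)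
    · rw [pairProd, pairProd, norm_prod, norm_prod]
      exact Finset.prod_le_prod (fun _ _ => norm_nonneg _)
        fun a _ => norm_pairFactor_le hθ hε.1.le hε.2 _ _ _
    · refine (norm_add_le _ _).trans (add_le_add le_rfl ((norm_sum_le _ _).trans
        (Finset.sum_le_sum fun a _ => ?_)))
      rw [norm_mul]
      exact mul_le_of_le_one_left (norm_nonneg _) (norm_pairDamping_le hε.1 _ _ _)
  · have hc : Continuous fun t => ‖pairProd (pairFactor θ ρ 1) t‖ * (‖∑ i, v i t‖ +
        ∑ a ∈ (Finset.univ : Finset (Idx n m)).offDiag, ‖K a.1 a.2 t‖) :=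
      (continuous_pairProd fun i k _ => continuous_pairFactor hθ hρ hρ1 1 i k).norm.mul
        ((continuous_finsetSum _ fun i _ => hv i).norm.add
          (continuous_finsetSum _ fun a _ => (hK _ _).norm))
    rw [anglesMeasure_eq_restrict]
    exact hc.continuousOn.integrableOn_compact isCompact_Icc

end PairFactor

/-! ### Polynomials on the torus -/

/-- The point `x_i = R_i e^{i t_i}` of the torus. -/
def torusPoint (R : Idx n m → ℝ) (t : Idx n m → ℝ) (i : Idx n m) : ℂ :=
  R i * Complex.exp (t i * Complex.I)

/-- The value of a polynomial at a point of the torus. -/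
def torusEval (R : Idx n m → ℝ) (p : Poly n m) (t : Idx n m → ℝ) : ℂ :=
  eval (torusPoint R t) p

theorem continuous_torusEval (R : Idx n m → ℝ) (p : Poly n m) : Continuous (torusEval R p) := by
  unfold torusEval
  refine (MvPolynomial.continuous_eval p).comp (continuous_pi fun i => ?_)
  unfold torusPoint
  fun_prop

theorem torusPoint_update_self (R t : Idx n m → ℝ) (i : Idx n m) (s : ℝ) :
    torusPoint R (Function.update t i s) i = R i * Complex.exp (s * Complex.I) := by
  simp [torusPoint]

theorem torusPoint_update_of_ne (R t : Idx n m → ℝ) {i k : Idx n m} (h : k ≠ i) (s : ℝ) :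
    torusPoint R (Function.update t i s) k = torusPoint R t k := by
  simp [torusPoint, Function.update_of_ne h]

theorem torusEval_update_add_two_pi (R : Idx n m → ℝ) (p : Poly n m) (t : Idx n m → ℝ)
    (i : Idx n m) :
    torusEval R p (Function.update t i (t i + 2 * Real.pi)) = torusEval R p t := by
  unfold torusEval
  congr 1
  congr 1
  funext k
  by_cases h : k = i
  · subst h
    rw [torusPoint_update_self, torusPoint]
    exact congrArg _ (periodic_exp_mul_I (t k))
  · exact torusPoint_update_of_ne R t h _

theorem hasDerivAt_torusEval (R : Idx n m → ℝ) (p : Poly n m) (t : Idx n m → ℝ) (i : Idx n m) :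
    HasDerivAt (fun s => torusEval R p (Function.update t i s))
      (Complex.I * torusEval R (X i * pderiv i p) t) (t i) := by
  induction p using MvPolynomial.induction_on with
  | C a => simpa [torusEval] using hasDerivAt_const (t i) a
  | add p q hp hq =>
    simp only [torusEval, map_add, mul_add] at hp hq ⊢
    exact hp.fun_add hq
  | mul_X p l hp =>
    have hl : HasDerivAt (fun s => torusPoint R (Function.update t i s) l)
        (Complex.I * (if l = i then torusPoint R t i else 0)) (t i) := by
      by_cases h : l = i
      · subst h
        simp only [torusPoint_update_self, if_true]
        exact hasDerivAt_mul_exp _ _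
      · simp only [torusPoint_update_of_ne R t h, h, if_false, mul_zero]
        exact hasDerivAt_const _ _
    simp only [torusEval, map_mul, eval_X] at hp ⊢
    refine HasDerivAt.congr_deriv (hp.fun_mul hl) ?_
    by_cases h : l = i
    · subst h
      simp
      ring
    · simp [pderiv_X_of_ne h, h]
      ring

theorem conj_torusPoint_inv (R t : Idx n m → ℝ) (i : Idx n m) :
    starRingEnd ℂ (torusPoint R⁻¹ t i) = (torusPoint R t i)⁻¹ := by
  simp [torusPoint, ← Complex.exp_conj, ← Complex.exp_neg, mul_comm]

theorem torusPoint_inv (R t : Idx n m → ℝ) (i : Idx n m) :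
    torusPoint R⁻¹ t i = (starRingEnd ℂ (torusPoint R t i))⁻¹ := by
  rw [← map_inv₀, ← conj_torusPoint_inv, Complex.conj_conj]

/-- The point `1 / conj x` has the same angles as `x` and inverse radii. -/
theorem conjEval_torusPoint (R : Idx n m → ℝ) (q : Poly n m) (t : Idx n m → ℝ) :
    conjEval q (torusPoint R t) = starRingEnd ℂ (torusEval R⁻¹ q t) := by
  simp only [conjEval, torusEval]
  congr 3
  funext i
  exact (torusPoint_inv R t i).symm

theorem exp_sub_mul_I (a b : ℝ) : Complex.exp (((a - b : ℝ) : ℂ) * Complex.I) =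
    Complex.exp (a * Complex.I) / Complex.exp (b * Complex.I) := by
  rw [← Complex.exp_sub]
  congr 1
  push_cast
  ring

theorem chordSq_eq (s : ℝ) : (chordSq s : ℂ) =
    (1 - Complex.exp (s * Complex.I)) * (1 - (Complex.exp (s * Complex.I))⁻¹) := by
  have h := Complex.exp_ne_zero (s * Complex.I)
  rw [chordSq]
  push_cast
  rw [Complex.cos, neg_mul, Complex.exp_neg]
  field_simp
  ring

theorem two_sin_eq (s : ℝ) : ((2 * Real.sin s : ℝ) : ℂ) =
    -Complex.I * (Complex.exp (s * Complex.I) - (Complex.exp (s * Complex.I))⁻¹) := by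
  push_cast
  rw [Complex.sin, neg_mul, Complex.exp_neg]
  ring

/-- This is `cot (s/2) = i (e^{is} + 1)/(e^{is} - 1)` with denominators cleared, so that it also
holds at coincident points. -/
theorem two_sin_mul_sub (R t : Idx n m → ℝ) {i k : Idx n m} (h : R i = R k) :
    ((2 * Real.sin (t i - t k) : ℝ) : ℂ) * (torusPoint R t i - torusPoint R t k) =
      Complex.I * chordSq (t i - t k) * (torusPoint R t i + torusPoint R t k) := by
  have h1 := Complex.exp_ne_zero (t i * Complex.I)
  have h2 := Complex.exp_ne_zero (t k * Complex.I)
  rw [two_sin_eq, chordSq_eq, exp_sub_mul_I, torusPoint, torusPoint, h]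
  field_simp
  ring

/-! ### The Hermitian product as an integral over angles -/

/-- The radii `ξ` of the `z`-variables and `ξ'` of the `w`-variables. -/
def radii (ξ ξ' : ℝ) : Idx n m → ℝ := Sum.elim (fun _ => ξ) (fun _ => ξ')

/-- The product `⟨p, q⟩'` without its normalization, as an integral over angles. -/
def angleForm (θ ξ ξ' : ℝ) (p q : Poly n m) : ℂ :=
  ∫ t, pairProd (pairFactor θ (ξ / ξ') 0) t *
    (torusEval (radii ξ ξ') p t * starRingEnd ℂ (torusEval (radii ξ ξ')⁻¹ q t))
      ∂anglesMeasure (Idx n m)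

theorem torusPoint_radii (ξ ξ' : ℝ) (t : Fin n → ℝ) (u : Fin m → ℝ) :
    Sum.elim (torusMap 0 (fun _ => ξ) t) (torusMap 0 (fun _ => ξ') u) =
      torusPoint (radii ξ ξ') (Sum.elim t u) := by
  funext i
  rcases i with i | i <;> simp [torusMap, torusPoint, radii]

theorem prod_offDiag_eq {ι M : Type*} [Fintype ι] [DecidableEq ι] [CommMonoid M] (f : ι → ι → M) :
    ∏ a ∈ (Finset.univ : Finset ι).offDiag, f a.1 a.2 =
      ∏ i, ∏ k ∈ Finset.univ.erase i, f i k := by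
  refine Finset.prod_finset_product' _ _ _ fun a => ?_
  simp [eq_comm]

theorem sum_offDiag_eq {ι M : Type*} [Fintype ι] [DecidableEq ι] [AddCommMonoid M]
    (f : ι → ι → M) : ∑ a ∈ (Finset.univ : Finset ι).offDiag, f a.1 a.2 =
      ∑ i, ∑ k ∈ Finset.univ.erase i, f i k := by
  refine Finset.sum_finset_product' _ _ _ fun a => ?_
  simp [eq_comm]

theorem sum_offDiag_eq_zero {ι : Type*} [Fintype ι] [DecidableEq ι] {f : ι → ι → ℂ}
    (h : ∀ i k, i ≠ k → f i k + f k i = 0) :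
    ∑ a ∈ (Finset.univ : Finset ι).offDiag, f a.1 a.2 = 0 := by
  refine Finset.sum_involution (fun a _ => a.swap) ?_ ?_ ?_ ?_
  · intro a ha
    exact h a.1 a.2 (Finset.mem_offDiag.1 ha).2.2
  · intro a ha _ e
    exact (Finset.mem_offDiag.1 ha).2.2 (congrArg Prod.snd e)
  · intro a ha
    simpa [eq_comm] using ha
  · intro a _
    exact Prod.swap_swap a

theorem regPow_neg (γ ε s : ℝ) : regPow γ ε (-s) = regPow γ ε s := by
  simp [regPow, chordSq]

/-- Each unordered pair is met in both orders, which accounts for the exponent `θ / 2`; the common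
radius cancels in the ratios. -/
theorem weight_torusMap {N : ℕ} {θ : ℝ} (hθ : 0 < θ) {ξ : ℝ} (hξ : 0 < ξ) (t : Fin N → ℝ) :
    weight θ (torusMap 0 (fun _ => ξ) t) =
      ∏ j, ∏ k ∈ Finset.univ.erase j, regPow (θ / 2) 0 (t j - t k) := by
  have h := Finset.prod_prod_Ioi_mul_eq_prod_prod_off_diag
    fun j k : Fin N => regPow (θ / 2) 0 (t k - t j)
  simp only [Finset.compl_singleton] at h
  rw [← h, weight]
  refine Finset.prod_congr rfl fun j _ => Finset.prod_congr rfl fun k _ => ?_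
  have hξ' : (ξ : ℂ) ≠ 0 := Complex.ofReal_ne_zero.2 hξ.ne'
  rw [← neg_sub (t j) (t k), regPow_neg, regPow, add_zero, ← Complex.ofReal_mul,
    ← Real.rpow_add_of_nonneg (chordSq_nonneg _) (by positivity) (by positivity), add_halves,
    Complex.ofReal_cpow (chordSq_nonneg _), chordSq_eq, exp_sub_mul_I, inv_div]
  simp only [torusMap, Pi.zero_apply, zero_add, mul_div_mul_left _ _ hξ']

theorem superWeight_torusMap {θ : ℝ} (hθ : 0 < θ) {ξ ξ' : ℝ} (hξ : 0 < ξ) (hξ' : 0 < ξ')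
    (t : Fin n → ℝ) (u : Fin m → ℝ) :
    superWeight θ (torusMap 0 (fun _ => ξ) t) (torusMap 0 (fun _ => ξ') u) =
      pairProd (pairFactor θ (ξ / ξ') 0) (Sum.elim t u) := by
  have e : ∀ (α : Type) [Fintype α] [DecidableEq α] (i : α) (f : α → ℂ),
      ∏ k ∈ Finset.univ.erase i, f k = ∏ k, if k = i then 1 else f k := by
    intro α _ _ i f
    rw [Finset.prod_ite, Finset.prod_const_one, one_mul]
    congr 1
    ext k
    simp
  have hcross : ∏ j, ∏ k, crossFactor (ξ / ξ') (t j - u k) =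
      (∏ j, ∏ k, ((1 - torusMap 0 (fun _ => ξ) t j / torusMap 0 (fun _ => ξ') u k) *
        (1 - torusMap 0 (fun _ => ξ') u k / torusMap 0 (fun _ => ξ) t j)))⁻¹ := by
    simp only [← Finset.prod_inv_distrib]
    refine Finset.prod_congr rfl fun j _ => Finset.prod_congr rfl fun k _ => ?_
    rw [crossFactor, exp_sub_mul_I, Complex.ofReal_div, div_mul_div_comm, inv_div]
    simp [torusMap]
  rw [superWeight, weight_torusMap hθ hξ, weight_torusMap (by positivity) hξ', div_eq_mul_inv,
    ← hcross, pairProd,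
    prod_offDiag_eq fun i k => pairFactor θ (ξ / ξ') 0 i k (Sum.elim t u i - Sum.elim t u k)]
  simp only [e, Fintype.prod_sum_type, Sum.inl.injEq, Sum.inr.injEq, reduceCtorEq, if_false,
    Sum.elim_inl, Sum.elim_inr, pairFactor, Finset.prod_mul_distrib, Finset.prod_const_one]
  ring

theorem hermProd_eq {θ : ℝ} (hθ : 0 < θ) {ξ ξ' : ℝ} (hξ : 0 < ξ) (h : ξ < ξ') (p q : Poly n m) :
    hermProd θ ξ ξ' p q = 1 / ((n.factorial : ℂ) * (m.factorial : ℂ)) *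
      ((1 / (2 * Real.pi) ^ n : ℂ) * ((1 / (2 * Real.pi) ^ m : ℂ) * angleForm θ ξ ξ' p q)) := by
  have hξ' := hξ.trans h
  have hc : Continuous fun t => pairProd (pairFactor (n := n) (m := m) θ (ξ / ξ') 0) t *
      (torusEval (radii ξ ξ') p t * starRingEnd ℂ (torusEval (radii ξ ξ')⁻¹ q t)) :=
    (continuous_pairProd fun i k _ => continuous_pairFactor hθ (div_pos hξ hξ')
      ((div_lt_one hξ').2 h) 0 i k).mul ((continuous_torusEval _ _).mul
        (Complex.continuous_conj.comp (continuous_torusEval _ _)))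
  rw [hermProd, torusMean_eq hξ]
  congr 2
  simp only [torusMean_eq hξ']
  rw [MeasureTheory.integral_const_mul]
  congr 1
  rw [angleForm, ← integral_anglesMeasure_sum hc]
  simp only [superWeight_torusMap hθ hξ hξ', torusPoint_radii, conjEval_torusPoint, torusEval,
    mul_assoc]

/-! ### Symmetry of the quantum integrals -/

/-- The discrete product rule `ab - a'b' = (a - a')b + a'(b - b')`. Here `c` plays the role of `c'
(x + y)/(x - y)`, but the undivided hypothesis also covers `x = y`. -/
theorem mul_sub_eq_of_dividedDiff {x y a a' b b' d e c c' : ℂ} (hx : x ≠ 0) (hy : y ≠ 0)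
    (ha : a - a' = (x - y) * d) (hb : b - b' = (x⁻¹ - y⁻¹) * e)
    (hc : c * (x - y) = c' * (x + y)) :
    c * (a * b - a' * b') = c' * ((x + y) * d * b - a' * (x⁻¹ + y⁻¹) * e) := by
  have h : c * (x⁻¹ - y⁻¹) = -(c' * (x⁻¹ + y⁻¹)) := by
    field_simp
    linear_combination -hc
  linear_combination c * b * ha + c * a' * hb + d * b * hc + a' * e * h

/-- The product rule breaks the symmetry between the two points, but its outcome is symmetric. -/
theorem dividedDiff_mul_symm {x y a a' b b' d e : ℂ} (hx : x ≠ 0) (hy : y ≠ 0)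
    (ha : a - a' = (x - y) * d) (hb : b - b' = (x⁻¹ - y⁻¹) * e) :
    (x + y) * d * b - a' * (x⁻¹ + y⁻¹) * e = (y + x) * d * b' - a * (y⁻¹ + x⁻¹) * e := by
  have h : (x + y) * (x⁻¹ - y⁻¹) + (x - y) * (x⁻¹ + y⁻¹) = 0 := by
    field_simp
    ring
  linear_combination (x + y) * d * hb + (x⁻¹ + y⁻¹) * e * ha + d * e * h

/-- The coefficient relating the logarithmic derivative of a pair factor to
`(x_i + x_k) / (x_i - x_k)`. -/
def pairCoeff (θ : ℝ) : Idx n m → Idx n m → ℂ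
  | Sum.inl _, Sum.inl _ => Complex.I * (θ / 2 : ℝ)
  | Sum.inr _, Sum.inr _ => Complex.I * (1 / θ / 2 : ℝ)
  | Sum.inl _, Sum.inr _ => -Complex.I
  | Sum.inr _, Sum.inl _ => 0

/-- Here the weight meets the recursion: exponents `θ`, `1/θ` and `-1` in Δ match `(-θ)^{1 - p(i) -
p(k)}`. Only the sum over both orders matters, so the mixed factor may sit on one order alone. -/
theorem pairCoeff_add_pairCoeff {θ : ℝ} (hθ : θ ≠ 0) (i k : Idx n m) :
    pairCoeff θ i k + pairCoeff θ k i =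
      -Complex.I * ((-(θ : ℂ)) ^ (-parity i) * (-(θ : ℂ)) ^ (1 - parity k)) := by
  have hθ' : (θ : ℂ) ≠ 0 := Complex.ofReal_ne_zero.2 hθ
  rcases i with i | i <;> rcases k with k | k <;>
    simp only [pairCoeff, parity_inl, parity_inr, sub_zero, sub_self, neg_zero, zpow_zero, zpow_one,
      zpow_neg_one] <;> push_cast <;> field_simp <;> ring

theorem weight_parity_symm {θ : ℝ} (hθ : θ ≠ 0) (i k : Idx n m) :
    (-(θ : ℂ)) ^ (-parity i) * (-(θ : ℂ)) ^ (1 - parity k) =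
      (-(θ : ℂ)) ^ (-parity k) * (-(θ : ℂ)) ^ (1 - parity i) := by
  have hθ' : -(θ : ℂ) ≠ 0 := neg_ne_zero.2 (Complex.ofReal_ne_zero.2 hθ)
  rw [← zpow_add₀ hθ', ← zpow_add₀ hθ']
  congr 1
  ring

section

variable {ξ ξ' : ℝ}

theorem torusPoint_radii_ne_zero (hξ : 0 < ξ) (hξ' : 0 < ξ') (t : Idx n m → ℝ) (i : Idx n m) :
    torusPoint (radii ξ ξ') t i ≠ 0 := by
  refine mul_ne_zero (Complex.ofReal_ne_zero.2 ?_) (Complex.exp_ne_zero _)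
  rcases i with i | i
  · exact hξ.ne'
  · exact hξ'.ne'

theorem regPowLog_mul_sub {γ ε : ℝ} (hε : 0 < ε) (R t : Idx n m → ℝ) {i k : Idx n m}
    (h : R i = R k) :
    regPowLog γ ε (t i - t k) * (torusPoint R t i - torusPoint R t k) =
      damping ε (t i - t k) * (Complex.I * γ) * (torusPoint R t i + torusPoint R t k) := by
  have h1 := two_sin_mul_sub R t h
  have h2 : ((chordSq (t i - t k) + ε : ℝ) : ℂ) ≠ 0 :=
    Complex.ofReal_ne_zero.2 (add_pos_of_nonneg_of_pos (chordSq_nonneg _) hε).ne'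
  rw [regPowLog, damping, Complex.ofReal_div, Complex.ofReal_div, Complex.ofReal_mul]
  field_simp
  linear_combination (γ : ℂ) * h1

theorem pairFactorLog_mul_sub (hξ : 0 < ξ) (h : ξ < ξ') {ε : ℝ} (hε : 0 < ε) {θ : ℝ}
    (t : Idx n m → ℝ) {i k : Idx n m} (hik : ¬ (i.isRight ∧ k.isLeft)) :
    pairFactorLog θ (ξ / ξ') ε i k (t i - t k) *
        (torusPoint (radii ξ ξ') t i - torusPoint (radii ξ ξ') t k) =
      pairDamping ε i k (t i - t k) * pairCoeff θ i k *
        (torusPoint (radii ξ ξ') t i + torusPoint (radii ξ ξ') t k) := by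
  have hξ' := hξ.trans h
  rcases i with i | i <;> rcases k with k | k
  · exact regPowLog_mul_sub hε _ t rfl
  · have h1 := mul_exp_sub_one_ne_zero (div_pos hξ hξ') ((div_lt_one hξ').2 h)
      (t (Sum.inl i) - t (Sum.inr k))
    have h2 := torusPoint_radii_ne_zero hξ hξ' t (Sum.inr k)
    have h3 : ((ξ / ξ' : ℝ) : ℂ) *
        Complex.exp (((t (Sum.inl i) - t (Sum.inr k) : ℝ) : ℂ) * Complex.I) =
        torusPoint (radii ξ ξ') t (Sum.inl i) / torusPoint (radii ξ ξ') t (Sum.inr k) := by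
      rw [exp_sub_mul_I, Complex.ofReal_div, div_mul_div_comm]
      rfl
    simp only [pairFactorLog, crossFactorLog, pairDamping, pairCoeff, one_mul]
    rw [h3] at h1 ⊢
    generalize torusPoint (radii ξ ξ') t (Sum.inl i) = x at *
    generalize torusPoint (radii ξ ξ') t (Sum.inr k) = y at *
    have h4 : x - y ≠ 0 := by
      rw [div_sub_one h2] at h1
      exact fun e => h1 (by rw [e, zero_div])
    rw [div_sub_one h2, div_add_one h2]
    field_simp
  · simp at hik
  · exact regPowLog_mul_sub hε _ t rfl

theorem IsStep.torusEval_eq {θ : ℝ} {F F' : Idx n m → Poly n m}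
    {D : Idx n m → Idx n m → Poly n m}
    (hF' : ∀ i, F' i = C ((-(θ : ℂ)) ^ parity i) * (X i * pderiv i (F i)) -
      C (1 / 2 : ℂ) * ∑ k ∈ Finset.univ.erase i,
        C ((-(θ : ℂ)) ^ (1 - parity k)) * ((X i + X k) * D i k)) (R t : Idx n m → ℝ)
    (i : Idx n m) :
    torusEval R (F' i) t = (-(θ : ℂ)) ^ parity i * torusEval R (X i * pderiv i (F i)) t -
      1 / 2 * ∑ k ∈ Finset.univ.erase i, (-(θ : ℂ)) ^ (1 - parity k) *
        ((torusPoint R t i + torusPoint R t k) * torusEval R (D i k) t) := by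
  rw [hF']
  simp only [torusEval, map_sub, map_mul, map_sum, map_add, eval_C, eval_X]

/-- Integration by parts with `u_i = a_i b_i`. Quasi-invariance plays no role, only the existence of
polynomial divided differences. -/
theorem sum_angleForm_step {θ : ℝ} (hθ : 0 < θ) (hξ : 0 < ξ) (h : ξ < ξ')
    {F F' G G' : Idx n m → Poly n m} (hF : IsStep θ F F') (hG : IsStep θ G G') :
    ∑ i, (-(θ : ℂ)) ^ (-parity i) * angleForm θ ξ ξ' (F' i) (G i) =
      ∑ i, (-(θ : ℂ)) ^ (-parity i) * angleForm θ ξ ξ' (F i) (G' i) := by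
  obtain ⟨D, hD, hF'⟩ := hF
  obtain ⟨E, hE, hG'⟩ := hG
  have hξ' := hξ.trans h
  have hρ := div_pos hξ hξ'
  have hρ1 := (div_lt_one hξ').2 h
  have hθ' : -(θ : ℂ) ≠ 0 := neg_ne_zero.2 (Complex.ofReal_ne_zero.2 hθ.ne')
  set R : Idx n m → ℝ := radii ξ ξ' with hR
  -- values of the polynomials on the torus
  set x : Idx n m → (Idx n m → ℝ) → ℂ := fun i t => torusPoint R t i with hx
  set a : Idx n m → (Idx n m → ℝ) → ℂ := fun i => torusEval R (F i) with ha
  set a1 : Idx n m → (Idx n m → ℝ) → ℂ := fun i => torusEval R (X i * pderiv i (F i)) with ha1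
  set d : Idx n m → Idx n m → (Idx n m → ℝ) → ℂ := fun i k => torusEval R (D i k) with hd
  set b : Idx n m → (Idx n m → ℝ) → ℂ := fun i t => starRingEnd ℂ (torusEval R⁻¹ (G i) t) with hb
  set b1 : Idx n m → (Idx n m → ℝ) → ℂ :=
    fun i t => starRingEnd ℂ (torusEval R⁻¹ (X i * pderiv i (G i)) t) with hb1
  set e : Idx n m → Idx n m → (Idx n m → ℝ) → ℂ :=
    fun i k t => starRingEnd ℂ (torusEval R⁻¹ (E i k) t) with he
  have hx0 : ∀ i t, x i t ≠ 0 := fun i t => torusPoint_radii_ne_zero hξ hξ' t i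
  have hdiffa : ∀ i k t, a i t - a k t = (x i t - x k t) * d i k t := by
    intro i k t
    have := congrArg (eval (torusPoint R t)) (hD i k)
    simp only [map_sub, map_mul, eval_X] at this
    exact this
  have hdiffb : ∀ i k t, b i t - b k t = ((x i t)⁻¹ - (x k t)⁻¹) * e i k t := by
    intro i k t
    have := congrArg (fun p => starRingEnd ℂ (eval (torusPoint R⁻¹ t) p)) (hE i k)
    simp only [map_sub, map_mul, eval_X, conj_torusPoint_inv] at this
    exact this
  have hac : ∀ i, Continuous (a i) := fun i => continuous_torusEval _ _
  have ha1c : ∀ i, Continuous (a1 i) := fun i => continuous_torusEval _ _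
  have hdc : ∀ i k, Continuous (d i k) := fun i k => continuous_torusEval _ _
  have hbc : ∀ i, Continuous (b i) := fun i =>
    Complex.continuous_conj.comp (continuous_torusEval _ _)
  have hb1c : ∀ i, Continuous (b1 i) := fun i =>
    Complex.continuous_conj.comp (continuous_torusEval _ _)
  have hec : ∀ i k, Continuous (e i k) := fun i k =>
    Complex.continuous_conj.comp (continuous_torusEval _ _)
  have hxc : ∀ i, Continuous (x i) := by
    intro i
    simp only [hx, torusPoint]
    fun_prop
  have hxic : ∀ i, Continuous fun t => (x i t)⁻¹ := fun i => (hxc i).inv₀ (hx0 i)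
  set M : Idx n m → Idx n m → (Idx n m → ℝ) → ℂ := fun i k t =>
    (x i t + x k t) * d i k t * b i t - a k t * ((x i t)⁻¹ + (x k t)⁻¹) * e i k t with hM
  have hMc : ∀ i k, Continuous (M i k) := fun i k =>
    ((((hxc i).add (hxc k)).mul (hdc i k)).mul (hbc i)).sub
      (((hac k).mul ((hxic i).add (hxic k))).mul (hec i k))
  -- The minus sign in `v` arises because conjugation sends the factor `I` of the angular derivative
  -- to `-I`.
  have hzero := integral_pairProd_zero_mul_eq_zero hθ hρ hρ1
    (u := fun i t => a i t * b i t)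
    (v := fun i t => Complex.I * (a1 i t * b i t - a i t * b1 i t))
    (K := fun i k t => pairCoeff θ i k * M i k t)
    (fun i => (hac i).mul (hbc i))
    (fun i => continuous_const.mul (((ha1c i).mul (hbc i)).sub ((hac i).mul (hb1c i))))
    (fun i k => continuous_const.mul (hMc i k)) ?_ ?_ ?_
  rotate_left
  · intro i t
    have h1 := hasDerivAt_torusEval R (F i) t i
    have h2 := (hasDerivAt_torusEval R⁻¹ (G i) t i).star
    refine HasDerivAt.congr_deriv (h1.fun_mul h2) ?_
    simp only [Function.update_eq_self, star_mul', Complex.star_def, Complex.conj_I, ha1, hb, ha,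
      hb1]
    ring
  · intro i t
    simp only [ha, hb, torusEval_update_add_two_pi]
  · intro ε hε i k t hik
    by_cases hlr : i.isRight ∧ k.isLeft
    · rcases i with i | i
      · simp at hlr
      · rcases k with k | k
        · simp [pairFactorLog, pairCoeff]
        · simp at hlr
    · rw [← mul_assoc]
      exact mul_sub_eq_of_dividedDiff (hx0 i t) (hx0 k t) (hdiffa i k t) (hdiffb i k t)
        (pairFactorLog_mul_sub hξ h hε t hlr)
  -- the integrand is the difference of the two sides
  have hpt : ∀ t, ∑ i, Complex.I * (a1 i t * b i t - a i t * b1 i t) +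
      ∑ p ∈ (Finset.univ : Finset (Idx n m)).offDiag, pairCoeff θ p.1 p.2 * M p.1 p.2 t =
      Complex.I * ∑ i, (-(θ : ℂ)) ^ (-parity i) * (torusEval R (F' i) t * b i t -
        a i t * starRingEnd ℂ (torusEval R⁻¹ (G' i) t)) := by
    intro t
    have hb' : ∀ i, starRingEnd ℂ (torusEval R⁻¹ (G' i) t) = (-(θ : ℂ)) ^ parity i * b1 i t -
        1 / 2 * ∑ k ∈ Finset.univ.erase i, (-(θ : ℂ)) ^ (1 - parity k) *
          (((x i t)⁻¹ + (x k t)⁻¹) * e i k t) := by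
      intro i
      rw [IsStep.torusEval_eq hG']
      simp only [map_sub, map_mul, map_sum, map_zpow₀, map_neg, Complex.conj_ofReal, map_add,
        conj_torusPoint_inv, map_div₀, map_one, map_ofNat]
      rfl
    have hcancel : ∀ i : Idx n m, (-(θ : ℂ)) ^ (-parity i) * (-(θ : ℂ)) ^ parity i = 1 := fun i => by
      rw [← zpow_add₀ hθ', neg_add_cancel, zpow_zero]
    have hterm : ∀ i, (-(θ : ℂ)) ^ (-parity i) * (torusEval R (F' i) t * b i t -
        a i t * starRingEnd ℂ (torusEval R⁻¹ (G' i) t)) =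
        (a1 i t * b i t - a i t * b1 i t) - ∑ k ∈ Finset.univ.erase i,
          1 / 2 * ((-(θ : ℂ)) ^ (-parity i) * (-(θ : ℂ)) ^ (1 - parity k)) *
            ((x i t + x k t) * d i k t * b i t - a i t * ((x i t)⁻¹ + (x k t)⁻¹) * e i k t) := by
      intro i
      have hs : ∑ k ∈ Finset.univ.erase i,
          1 / 2 * ((-(θ : ℂ)) ^ (-parity i) * (-(θ : ℂ)) ^ (1 - parity k)) *
            ((x i t + x k t) * d i k t * b i t - a i t * ((x i t)⁻¹ + (x k t)⁻¹) * e i k t) =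
          1 / 2 * (-(θ : ℂ)) ^ (-parity i) * ((∑ k ∈ Finset.univ.erase i,
            (-(θ : ℂ)) ^ (1 - parity k) * ((x i t + x k t) * d i k t)) * b i t -
            a i t * ∑ k ∈ Finset.univ.erase i, (-(θ : ℂ)) ^ (1 - parity k) *
              (((x i t)⁻¹ + (x k t)⁻¹) * e i k t)) := by
        rw [Finset.sum_mul, Finset.mul_sum, ← Finset.sum_sub_distrib, Finset.mul_sum]
        refine Finset.sum_congr rfl fun k _ => ?_
        ring
      rw [hs, IsStep.torusEval_eq hF', hb']
      linear_combination (a1 i t * b i t - a i t * b1 i t) * hcancel i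
    -- `M` pairs `b_i` with `a_k`, while the recursion gives `b_i` with `a_i`. They match only after
    -- adding the orders `(i, k)` and `(k, i)`, by the symmetry of `M` and of the coefficients; this
    -- is the source of the factor `1/2` in the recursion.
    have hanti := sum_offDiag_eq_zero (f := fun i k => pairCoeff θ i k * M i k t +
      Complex.I * (1 / 2 * ((-(θ : ℂ)) ^ (-parity i) * (-(θ : ℂ)) ^ (1 - parity k)) *
        ((x i t + x k t) * d i k t * b i t - a i t * ((x i t)⁻¹ + (x k t)⁻¹) * e i k t))) ?_
    · rw [Finset.sum_add_distrib, ← Finset.mul_sum] at hanti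
      rw [Finset.sum_congr rfl fun i _ => hterm i, Finset.sum_sub_distrib,
        ← sum_offDiag_eq fun i k => 1 / 2 * ((-(θ : ℂ)) ^ (-parity i) *
          (-(θ : ℂ)) ^ (1 - parity k)) * ((x i t + x k t) * d i k t * b i t -
            a i t * ((x i t)⁻¹ + (x k t)⁻¹) * e i k t), ← Finset.mul_sum]
      linear_combination hanti
    · intro i k hik
      have hsymm := dividedDiff_mul_symm (hx0 i t) (hx0 k t) (hdiffa i k t) (hdiffb i k t)
      have hdsymm : d k i = d i k := by
        simp only [hd, dividedDiff_symm hD hik]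
      have hesymm : e k i = e i k := by
        simp only [he, dividedDiff_symm hE hik]
      have hco := pairCoeff_add_pairCoeff hθ.ne' i k
      have hw := weight_parity_symm hθ.ne' i k
      simp only [hM, hdsymm, hesymm]
      rw [← hw]
      generalize (-(θ : ℂ)) ^ (-parity i) * (-(θ : ℂ)) ^ (1 - parity k) = w at hco
      linear_combination ((x i t + x k t) * d i k t * b i t -
        a k t * ((x i t)⁻¹ + (x k t)⁻¹) * e i k t) * hco -
          (pairCoeff θ k i + Complex.I * w / 2) * hsymm
  simp only [hpt] at hzero
  have hPc : Continuous (pairProd (pairFactor (n := n) (m := m) θ (ξ / ξ') 0)) :=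
    continuous_pairProd fun i k _ => continuous_pairFactor hθ hρ hρ1 0 i k
  have hint : ∀ p q : Poly n m, MeasureTheory.Integrable (fun t =>
      pairProd (pairFactor θ (ξ / ξ') 0) t *
        (torusEval R p t * starRingEnd ℂ (torusEval R⁻¹ q t))) (anglesMeasure (Idx n m)) :=
    fun p q => integrable_anglesMeasure (hPc.mul ((continuous_torusEval _ _).mul
      (Complex.continuous_conj.comp (continuous_torusEval _ _))))
  rw [← sub_eq_zero, ← Finset.sum_sub_distrib]
  simp only [← mul_sub, angleForm, ← hR]
  simp only [← MeasureTheory.integral_sub (hint _ _) (hint _ _),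
    ← MeasureTheory.integral_const_mul]
  have hint' : ∀ i ∈ Finset.univ, MeasureTheory.Integrable (fun t => (-(θ : ℂ)) ^ (-parity i) *
      (pairProd (pairFactor θ (ξ / ξ') 0) t *
        (torusEval R (F' i) t * starRingEnd ℂ (torusEval R⁻¹ (G i) t)) -
      pairProd (pairFactor θ (ξ / ξ') 0) t *
        (torusEval R (F i) t * starRingEnd ℂ (torusEval R⁻¹ (G' i) t)))) (anglesMeasure (Idx n m)) :=
    fun i _ => ((hint _ _).sub (hint _ _)).const_mul _
  rw [← MeasureTheory.integral_finsetSum _ hint']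
  apply mul_left_cancel₀ Complex.I_ne_zero
  rw [mul_zero, ← MeasureTheory.integral_const_mul, ← hzero]
  refine MeasureTheory.integral_congr_ae (Filter.Eventually.of_forall fun t => ?_)
  simp only [Finset.mul_sum, hb, ha]
  refine Finset.sum_congr rfl fun i _ => ?_
  ring

theorem sum_angleForm_chain {θ : ℝ} (hθ : 0 < θ) (hξ : 0 < ξ) (h : ξ < ξ')
    {F G : ℕ → Idx n m → Poly n m} (hF : ∀ r, IsStep θ (F r) (F (r + 1)))
    (hG : ∀ r, IsStep θ (G r) (G (r + 1))) (r s : ℕ) :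
    ∑ i, (-(θ : ℂ)) ^ (-parity i) * angleForm θ ξ ξ' (F r i) (G s i) =
      ∑ i, (-(θ : ℂ)) ^ (-parity i) * angleForm θ ξ ξ' (F 0 i) (G (r + s) i) := by
  induction r generalizing s with
  | zero => rw [zero_add]
  | succ r ih => rw [sum_angleForm_step hθ hξ h (hF r) (hG s), ih (s + 1), Nat.succ_add_eq_add_succ]

theorem integrable_angleForm {θ : ℝ} (hθ : 0 < θ) (hξ : 0 < ξ) (h : ξ < ξ') (p q : Poly n m) :
    MeasureTheory.Integrable (fun t => pairProd (pairFactor θ (ξ / ξ') 0) t *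
      (torusEval (radii ξ ξ') p t * starRingEnd ℂ (torusEval (radii ξ ξ')⁻¹ q t)))
      (anglesMeasure (Idx n m)) :=
  integrable_anglesMeasure ((continuous_pairProd fun i k _ => continuous_pairFactor hθ
    (div_pos hξ (hξ.trans h)) ((div_lt_one (hξ.trans h)).2 h) 0 i k).mul
      ((continuous_torusEval _ _).mul (Complex.continuous_conj.comp (continuous_torusEval _ _))))

theorem angleForm_sum_left {θ : ℝ} (hθ : 0 < θ) (hξ : 0 < ξ) (h : ξ < ξ') (c : Idx n m → ℂ)
    (F : Idx n m → Poly n m) (q : Poly n m) :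
    angleForm θ ξ ξ' (∑ i, C (c i) * F i) q = ∑ i, c i * angleForm θ ξ ξ' (F i) q := by
  simp only [angleForm, ← MeasureTheory.integral_const_mul]
  rw [← MeasureTheory.integral_finsetSum _ fun i _ =>
    (integrable_angleForm hθ hξ h (F i) q).const_mul (c i)]
  refine MeasureTheory.integral_congr_ae (Filter.Eventually.of_forall fun t => ?_)
  simp only [torusEval, map_sum, map_mul, eval_C, Finset.sum_mul, Finset.mul_sum]
  refine Finset.sum_congr rfl fun i _ => ?_
  ring

/-- The form is conjugate-linear in this argument, so the coefficients must be real. -/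
theorem angleForm_sum_right {θ : ℝ} (hθ : 0 < θ) (hξ : 0 < ξ) (h : ξ < ξ') (c : Idx n m → ℂ)
    (hc : ∀ i, starRingEnd ℂ (c i) = c i) (p : Poly n m) (G : Idx n m → Poly n m) :
    angleForm θ ξ ξ' p (∑ i, C (c i) * G i) = ∑ i, c i * angleForm θ ξ ξ' p (G i) := by
  simp only [angleForm, ← MeasureTheory.integral_const_mul]
  rw [← MeasureTheory.integral_finsetSum _ fun i _ =>
    (integrable_angleForm hθ hξ h p (G i)).const_mul (c i)]
  refine MeasureTheory.integral_congr_ae (Filter.Eventually.of_forall fun t => ?_)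
  simp only [torusEval, map_sum, map_mul, eval_C, Finset.mul_sum, hc]
  refine Finset.sum_congr rfl fun i _ => ?_
  ring

theorem angleForm_symm {θ : ℝ} (hθ : 0 < θ) (hξ : 0 < ξ) (h : ξ < ξ')
    {F G : ℕ → Idx n m → Poly n m} {p q : Poly n m} (hF0 : F 0 = fun _ => p)
    (hG0 : G 0 = fun _ => q) (hF : ∀ r, IsStep θ (F r) (F (r + 1)))
    (hG : ∀ r, IsStep θ (G r) (G (r + 1))) (r : ℕ) :
    angleForm θ ξ ξ' (∑ i, C ((-(θ : ℂ)) ^ (-parity i)) * F r i) q =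
      angleForm θ ξ ξ' p (∑ i, C ((-(θ : ℂ)) ^ (-parity i)) * G r i) := by
  have hchain := sum_angleForm_chain hθ hξ h hF hG r 0
  rw [hF0, hG0, add_zero] at hchain
  rw [angleForm_sum_left hθ hξ h, angleForm_sum_right hθ hξ h, hchain]
  intro i
  rw [map_zpow₀, map_neg, Complex.conj_ofReal]

end

end DeformedCMS

end

/-! ### The main theorem -/

theorem mainTheorem2 (n m : ℕ) (θ : ℝ) (hθ : 0 < θ) (r : ℕ) (hr : 1 ≤ r) :
    ∃ L : DeformedCMS.quasiInvariants n m θ →ₗ[ℂ] DeformedCMS.quasiInvariants n m θ,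
      (∀ p : DeformedCMS.quasiInvariants n m θ,
        algebraMap (DeformedCMS.Poly n m) (DeformedCMS.RatFn n m) (L p) =
          DeformedCMS.quantumIntegral n m θ r
            (algebraMap (DeformedCMS.Poly n m) (DeformedCMS.RatFn n m) p)) ∧
      ∀ ξ ξ' : ℝ, 0 < ξ → ξ < ξ' → ∀ p q : DeformedCMS.quasiInvariants n m θ,
        DeformedCMS.hermProd θ ξ ξ' (L p : DeformedCMS.Poly n m) q =
          DeformedCMS.hermProd θ ξ ξ' (p : DeformedCMS.Poly n m) (L q) := by
  obtain ⟨L, hL⟩ := DeformedCMS.exists_linearMap_quasiInvariants (n := n) (m := m) hθ.ne' r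
  refine ⟨L, hL, fun ξ ξ' hξ h p q => ?_⟩
  have inj : Function.Injective (algebraMap (DeformedCMS.Poly n m) (DeformedCMS.RatFn n m)) :=
    IsFractionRing.injective _ _
  obtain ⟨F, hF0, hF, -⟩ := DeformedCMS.exists_stepChain p.2
  obtain ⟨G, hG0, hG, -⟩ := DeformedCMS.exists_stepChain q.2
  -- Injectivity into the fraction field identifies the chosen `L p` with the weighted sum along the
  -- chain of `p`.
  have hLp := inj ((hL p).trans (DeformedCMS.quantumIntegral_algebraMap hF0 hF r))
  have hLq := inj ((hL q).trans (DeformedCMS.quantumIntegral_algebraMap hG0 hG r))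
  rw [DeformedCMS.hermProd_eq hθ hξ h, DeformedCMS.hermProd_eq hθ hξ h, hLp, hLq, DeformedCMS.angleForm_symm hθ hξ h hF0 hG0 hF hG]
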